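/- Let $p,q\ge 1$, $n=p+q$, $m=\lfloor n/2\rfloor$, and let $\mathbb R^{p,q}$ be $\mathbb R^n$ with the bilinear form $\langle x,y\rangle_{p,q}=-x_1y_1-\dots-x_py_p+x_{p+1}y_{p+1}+\dots+x_ny_n$. Let $\mathrm{SO}_0(p,q)$ and $\mathrm{Spin}_0(p,q)$ be the identity components of $\mathrm{SO}(p,q)$ and $\mathrm{Spin}(p,q)$, let $\lambda:\mathrm{Spin}_0(p,q)\to\mathrm{SO}_0(p,q)$, $\lambda(g)v=g\cdot v\cdot g^{-1}$, be the covering, and let the Clifford algebra (with $x\cdot y+y\cdot x=-2\langle x,y\rangle_{p,q}$) act on $\Delta_{p,q}=\mathbb C^{2^m}$ by the standard Dirac spinor representation, given by Kronecker products of the $2\times 2$ matrices $E=\begin{pmatrix}1&0\\0&1\end{pmatrix}$, $U_1=\begin{pmatrix}i&0\\0&-i\end{pmatrix}$, $U_2=\begin{pmatrix}0&i\\i&0\end{pmatrix}$, $T=\begin{pmatrix}0&-i\\i&0\end{pmatrix}$ as follows: with $\tau_j=i$ for $j\le p$ and $\tau_j=1$ for $j>p$, the vector $e_j$, $j\le 2m$,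 acts as $\tau_j\,E\otimes\dots\otimes E\otimes U\otimes T\otimes\dots\otimes T$ with $\lfloor (j-1)/2\rfloor$ factors $T$, where $U=U_1$ for odd $j$ and $U=U_2$ for even $j$, and if $n=2m+1$, the vector $e_n$ acts as $\tau_n\, i\,T\otimes\dots\otimes T$. Spinor fields on $\mathbb R^{p,q}$ are functions $\psi:\mathbb R^n\to\Delta_{p,q}$, and the Dirac operator is $D\psi=\sum_{j=1}^n\langle e_j,e_j\rangle_{p,q}\; e_j\cdot\partial_j\psi$. Let $A:\mathbb R^n\to \mathrm{SO}_0(p,q)$ be smooth, let the Euclidean operator norms of $A(x)$ and $A(x)^{-1}$ be bounded on $\mathbb R^n$, and let $\xi_A(x)=\mathrm{span}\{A(x)e_1,\dots,A(x)e_p\}$ be the maximal time-like subbundle induced by $A$. It induces a continuous positive definite Hermitian bundle metric on spinors by $(\varphi,\psi)_{\xi_A}(x)=\langle g^{-1}\cdot\varphi(x),\,g^{-1}\cdot\psi(x)\rangle$, where $\langle\cdot,\cdot\rangle$ is the standard Hermitian product of $\mathbb C^{2^m}$ and $g\in \mathrm{Spin}_0(p,q)$ is an adapted spin frame at $x$,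 that is, $\lambda(g)e_1,\dots,\lambda(g)e_p$ span $\xi_A(x)$. Let $L^2_{\xi_A}(S)$ be the completion of $C_c^\infty(\mathbb R^n,\Delta_{p,q})$ with respect to the inner product $\int_{\mathbb R^n}(\varphi,\psi)_{\xi_A}\,dx$, and let $D_{\xi_A}$ be $D$ as an unbounded operator in $L^2_{\xi_A}(S)$ with domain $C_c^\infty(\mathbb R^n,\Delta_{p,q})$. Then $D_{\xi_A}$ is closable, and with its closure $\bar D_{\xi_A}$, $$\sigma(D_{\xi_A})=\sigma(\bar D_{\xi_A})=\sigma_c(\bar D_{\xi_A})=\mathbb C.$$ Here, for an operator $T$ in a Hilbert space $H$, the resolvent set consists of the $z\in\mathbb C$ for which $z-T$ is injective with dense range and has a bounded inverse (on its range), $\sigma(T)$ is the complement of the resolvent set, and $\sigma_c(T)$ consists of the $z$ for which $z-T$ is injective with dense range and has an unbounded inverse. -/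

import Mathlib

open scoped ContDiff Matrix

noncomputable section

namespace PseudoDirac

/-! ### The quadratic space `ℝ^{p,q}` and its groups -/

/-- `κ_j = ⟨e_j, e_j⟩_{p,q}`: the first `p` coordinates are time-like. -/
def metricSign (p q : ℕ) (j : Fin (p + q)) : ℝ := if j.val < p then -1 else 1

/-- The quadratic form `x ↦ -⟨x, x⟩_{p,q}`. In Mathlib's Clifford algebra of this form one has
`x · y + y · x = -2 ⟨x, y⟩_{p,q}`. -/
def negForm (p q : ℕ) : QuadraticForm ℝ (Fin (p + q) → ℝ) :=
  QuadraticMap.weightedSumSquares ℝ (fun j => -metricSign p q j)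

/-- The real Clifford algebra `Cl_{p,q}`. -/
abbrev Cl (p q : ℕ) : Type := CliffordAlgebra (negForm p q)

/-- The inclusion of vectors into the Clifford algebra. -/
abbrev vec (p q : ℕ) : (Fin (p + q) → ℝ) →ₗ[ℝ] Cl p q := CliffordAlgebra.ι (negForm p q)

/-- `SO(p,q)`, as a set of real matrices. -/
def SO (p q : ℕ) : Set (Matrix (Fin (p + q)) (Fin (p + q)) ℝ) :=
  {B | Bᵀ * Matrix.diagonal (metricSign p q) * B = Matrix.diagonal (metricSign p q) ∧ B.det = 1}

/-- `SO_0(p,q)`, the connected component of the identity of `SO(p,q)`. -/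
def SO₀ (p q : ℕ) : Set (Matrix (Fin (p + q)) (Fin (p + q)) ℝ) :=
  connectedComponentIn (SO p q) 1

/-- `Spin(p,q)`: Clifford products of an even number of vectors `v` with `⟨v, v⟩_{p,q} = ± 1`. -/
def Spin (p q : ℕ) : Set (Cl p q) :=
  {a | ∃ l : List (Fin (p + q) → ℝ), Even l.length ∧
    (∀ v ∈ l, negForm p q v = 1 ∨ negForm p q v = -1) ∧ a = (l.map (vec p q)).prod}

/-- `Spin_0(p,q)`, the connected component of the identity of `Spin(p,q)`, where the Clifford
algebra has its canonical topology as a finite-dimensional real vector space. -/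
def Spin₀ (p q : ℕ) : Set (Cl p q) :=
  letI : TopologicalSpace (Cl p q) := moduleTopology ℝ (Cl p q)
  connectedComponentIn (Spin p q) 1

/-- `λ(g) = B` for the covering `λ : Spin(p,q) → SO(p,q)`, `λ(g) v = g v g⁻¹`. -/
def Covers {p q : ℕ} (g : (Cl p q)ˣ) (B : Matrix (Fin (p + q)) (Fin (p + q)) ℝ) : Prop :=
  ∀ v, (g : Cl p q) * vec p q v * ((g⁻¹ : (Cl p q)ˣ) : Cl p q) = vec p q (B *ᵥ v)

/-! ### The Dirac spinor representation -/

/-- Index set of the standard basis of `(ℂ²)^{⊗ m}`, `m = [n/2]`, so that it has `2^m` elements. -/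
abbrev SpinIdx (p q : ℕ) : Type := Fin ((p + q) / 2) → Fin 2

/-- The Hermitian space `Δ_{p,q} = ℂ^{2^m}`. -/
abbrev Δ (p q : ℕ) : Type := EuclideanSpace ℂ (SpinIdx p q)

/-- The Kronecker product of `m` complex `2 × 2` matrices. -/
def kron {m : ℕ} (M : Fin m → Matrix (Fin 2) (Fin 2) ℂ) :
    Matrix (Fin m → Fin 2) (Fin m → Fin 2) ℂ :=
  Matrix.of fun s t => ∏ k, M k (s k) (t k)

def matU₁ : Matrix (Fin 2) (Fin 2) ℂ := !![Complex.I, 0; 0, -Complex.I]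

def matU₂ : Matrix (Fin 2) (Fin 2) ℂ := !![0, Complex.I; Complex.I, 0]

def matT : Matrix (Fin 2) (Fin 2) ℂ := !![0, -Complex.I; Complex.I, 0]

/-- `τ_j = i` for time-like and `1` for space-like indices. -/
def tau (p q : ℕ) (j : Fin (p + q)) : ℂ := if j.val < p then Complex.I else 1

/-- The tensor factor of the generator with (zero-based) number `j` at the `k`-th place counted
from the right: `[j/2]` factors `T`, then `U₁` (`j` even) or `U₂` (`j` odd), then factors `E`. -/
def factor (j k : ℕ) : Matrix (Fin 2) (Fin 2) ℂ :=
  if k < j / 2 then matT else if k = j / 2 then (if Even j then matU₁ else matU₂) else 1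

/-- The matrix by which `e_j` acts on spinors:
`τ_j E ⊗ … ⊗ E ⊗ U ⊗ T ⊗ … ⊗ T`, and `τ_j i T ⊗ … ⊗ T` for the last `j` if `n = p + q` is odd. -/
def gammaMat (p q : ℕ) (j : Fin (p + q)) : Matrix (SpinIdx p q) (SpinIdx p q) ℂ :=
  if j.val / 2 < (p + q) / 2 then tau p q j • kron (fun k => factor j.val k.val)
  else (tau p q j * Complex.I) • kron (fun _ => matT)

theorem kron_mul {m : ℕ} (M N : Fin m → Matrix (Fin 2) (Fin 2) ℂ) :
    kron M * kron N = kron (fun k => M k * N k) := by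
  ext s t
  simp only [kron, Matrix.mul_apply, Matrix.of_apply, ← Finset.prod_mul_distrib]
  exact (Fintype.prod_sum (fun k j => M k (s k) j * N k j (t k))).symm

theorem kron_smul {m : ℕ} (c : Fin m → ℂ) (M : Fin m → Matrix (Fin 2) (Fin 2) ℂ) :
    kron (fun k => c k • M k) = (∏ k, c k) • kron M := by
  ext s t
  simp [kron, Finset.prod_mul_distrib]

theorem kron_one {m : ℕ} : kron (fun _ : Fin m => (1 : Matrix (Fin 2) (Fin 2) ℂ)) = 1 := by
  ext s t
  simp only [kron, Matrix.of_apply, Matrix.one_apply]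
  by_cases h : s = t
  · simp [h]
  · rw [if_neg h]
    obtain ⟨k, hk⟩ := Function.ne_iff.mp h
    exact Finset.prod_eq_zero (Finset.mem_univ k) (by simp [hk])

theorem matU₁_sq : matU₁ * matU₁ = -1 := by
  ext i j; fin_cases i <;> fin_cases j <;> simp [matU₁, Matrix.mul_apply]

theorem matU₂_sq : matU₂ * matU₂ = -1 := by
  ext i j; fin_cases i <;> fin_cases j <;> simp [matU₂, Matrix.mul_apply]

theorem matT_sq : matT * matT = 1 := by
  ext i j; fin_cases i <;> fin_cases j <;> simp [matT, Matrix.mul_apply]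

theorem matU₁_matU₂ : matU₁ * matU₂ = -(matU₂ * matU₁) := by
  ext i j; fin_cases i <;> fin_cases j <;> simp [matU₁, matU₂, Matrix.mul_apply]

theorem matT_matU₁ : matT * matU₁ = -(matU₁ * matT) := by
  ext i j; fin_cases i <;> fin_cases j <;> simp [matU₁, matT, Matrix.mul_apply]

theorem matT_matU₂ : matT * matU₂ = -(matU₂ * matT) := by
  ext i j; fin_cases i <;> fin_cases j <;> simp [matU₂, matT, Matrix.mul_apply]

theorem factor_sq (j k : ℕ) :
    factor j k * factor j k = (if k = j / 2 then (-1 : ℂ) else 1) • (1 : Matrix _ _ ℂ) := by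
  unfold factor
  split_ifs <;> first | omega | simp [matU₁_sq, matU₂_sq, matT_sq]

theorem matT_factor (j k : ℕ) :
    matT * factor j k = (if k = j / 2 then (-1 : ℂ) else 1) • (factor j k * matT) := by
  unfold factor
  split_ifs <;> first | omega | simp [matT_matU₁, matT_matU₂]

theorem factor_factor {i j : ℕ} (hij : i < j) (k : ℕ) :
    factor j k * factor i k = (if k = i / 2 then (-1 : ℂ) else 1) • (factor i k * factor j k) := by
  by_cases h : k < j / 2
  · have : factor j k = matT := by simp [factor, h]
    rw [this, matT_factor]
  · by_cases h2 : k = i / 2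
    · have hij2 : j / 2 = i / 2 := by omega
      have hi : Even i := by rw [Nat.even_iff]; omega
      have hj : ¬ Even j := by rw [Nat.even_iff]; omega
      simp [factor, hij2, h2, hi, hj, matU₁_matU₂]
    · have : factor i k = 1 := by
        unfold factor; rw [if_neg (by omega), if_neg h2]
      simp [this, h2]

theorem prod_sign {m a : ℕ} (ha : a < m) :
    ∏ k : Fin m, (if k.val = a then (-1 : ℂ) else 1) = -1 := by
  rw [Finset.prod_eq_single (⟨a, ha⟩ : Fin m)]
  · simp
  · intro b _ hb
    rw [if_neg]
    exact fun h => hb (Fin.ext h)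
  · simp

theorem tau_sq (p q : ℕ) (j : Fin (p + q)) :
    tau p q j * tau p q j = ((metricSign p q j : ℝ) : ℂ) := by
  unfold tau metricSign; split_ifs <;> simp

theorem gammaMat_sq (p q : ℕ) (j : Fin (p + q)) :
    gammaMat p q j * gammaMat p q j = (((-metricSign p q j : ℝ)) : ℂ) • 1 := by
  unfold gammaMat
  split_ifs with h
  · rw [Matrix.smul_mul, Matrix.mul_smul, kron_mul]
    simp only [factor_sq]
    rw [kron_smul, kron_one, prod_sign h, smul_smul, smul_smul, tau_sq]
    push_cast; congr 1; ring
  · rw [Matrix.smul_mul, Matrix.mul_smul, kron_mul]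
    simp only [matT_sq]
    rw [kron_one, smul_smul]
    have : tau p q j * Complex.I * (tau p q j * Complex.I)
        = (tau p q j * tau p q j) * (Complex.I * Complex.I) := by ring
    rw [this, tau_sq, Complex.I_mul_I]
    push_cast; congr 1; ring

theorem gammaMat_anticomm_lt (p q : ℕ) {i j : Fin (p + q)} (hij : i.val < j.val) :
    gammaMat p q j * gammaMat p q i = -(gammaMat p q i * gammaMat p q j) := by
  have hi : i.val / 2 < (p + q) / 2 := by omega
  unfold gammaMat
  rw [if_pos hi]
  split_ifs with hj
  · simp only [Matrix.smul_mul, Matrix.mul_smul, kron_mul, factor_factor hij]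
    rw [kron_smul, prod_sign hi]
    simp only [smul_smul, ← neg_smul]
    congr 1; ring
  · simp only [Matrix.smul_mul, Matrix.mul_smul, kron_mul, matT_factor]
    rw [kron_smul, prod_sign hi]
    simp only [smul_smul, ← neg_smul]
    congr 1; ring

theorem gammaMat_anticomm (p q : ℕ) {i j : Fin (p + q)} (hij : i ≠ j) :
    gammaMat p q i * gammaMat p q j + gammaMat p q j * gammaMat p q i = 0 := by
  rcases lt_or_gt_of_ne hij with h | h
  · rw [gammaMat_anticomm_lt p q (i := i) (j := j) h]; simp
  · rw [gammaMat_anticomm_lt p q (i := j) (j := i) h]; simp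

/-- The linear action of vectors on spinors. -/
def gammaLin (p q : ℕ) : (Fin (p + q) → ℝ) →ₗ[ℝ] Matrix (SpinIdx p q) (SpinIdx p q) ℂ :=
  Fintype.linearCombination ℝ (gammaMat p q)

theorem gammaLin_sq (p q : ℕ) (v : Fin (p + q) → ℝ) :
    gammaLin p q v * gammaLin p q v = algebraMap ℝ _ (negForm p q v) := by
  have key : gammaLin p q v * gammaLin p q v =
      ∑ i, ∑ j, (v i * v j) • (gammaMat p q i * gammaMat p q j) := by
    simp only [gammaLin, Fintype.linearCombination_apply, Finset.sum_mul_sum, smul_mul_smul_comm]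
  have key2 : gammaLin p q v * gammaLin p q v =
      ∑ i, ∑ j, (v i * v j) • (gammaMat p q j * gammaMat p q i) := by
    rw [key, Finset.sum_comm]
    simp only [mul_comm (v _) (v _)]
  have h2 : (2 : ℝ) • (gammaLin p q v * gammaLin p q v) =
      (2 : ℝ) • algebraMap ℝ (Matrix (SpinIdx p q) (SpinIdx p q) ℂ) (negForm p q v) := by
    rw [two_smul]
    nth_rewrite 1 [key]
    rw [key2, ← Finset.sum_add_distrib]
    simp only [← Finset.sum_add_distrib, ← smul_add]
    have : ∀ i, ∑ j, (v i * v j) •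
        (gammaMat p q i * gammaMat p q j + gammaMat p q j * gammaMat p q i) =
        (2 : ℝ) • ((-metricSign p q i) * (v i * v i)) •
          (1 : Matrix (SpinIdx p q) (SpinIdx p q) ℂ) := by
      intro i
      rw [Finset.sum_eq_single i]
      · rw [gammaMat_sq, ← two_smul ℝ, Complex.coe_smul, smul_smul, smul_smul, smul_smul]
        congr 1; ring
      · intro j _ hj
        rw [gammaMat_anticomm p q (Ne.symm hj), smul_zero]
      · simp
    simp only [this]
    rw [← Finset.smul_sum, ← Finset.sum_smul, Algebra.algebraMap_eq_smul_one]
    simp [negForm, QuadraticMap.weightedSumSquares_apply]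
  exact smul_right_injective _ (two_ne_zero) h2

/-- The Dirac spinor representation `κ_{p,q}` of the Clifford algebra, in matrix form. -/
def spinRep (p q : ℕ) : Cl p q →ₐ[ℝ] Matrix (SpinIdx p q) (SpinIdx p q) ℂ :=
  CliffordAlgebra.lift (negForm p q) ⟨gammaLin p q, gammaLin_sq p q⟩

/-- Clifford multiplication `φ ↦ a · φ` on spinors. -/
def act {p q : ℕ} (a : Cl p q) : Δ p q →L[ℂ] Δ p q :=
  Matrix.toEuclideanCLM (𝕜 := ℂ) (spinRep p q a)

theorem act_mul {p q : ℕ} (a b : Cl p q) (φ : Δ p q) : act (a * b) φ = act a (act b φ) := by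
  simp [act, map_mul]

theorem act_one {p q : ℕ} (φ : Δ p q) : act (1 : Cl p q) φ = φ := by
  simp [act]

/-! ### Time-like subbundles and the metrics they induce on spinors -/

/-- The manifold `ℝ^n`, `n = p + q`. -/
abbrev Base (p q : ℕ) : Type := EuclideanSpace ℝ (Fin (p + q))

/-- `span (B e_1, …, B e_p)`. -/
def timeSpan {p q : ℕ} (B : Matrix (Fin (p + q)) (Fin (p + q)) ℝ) :
    Submodule ℝ (Fin (p + q) → ℝ) :=
  Submodule.span ℝ {v | ∃ j : Fin (p + q), j.val < p ∧ v = B *ᵥ Pi.single j 1}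

/-- The fibre `Q_ξ` at a point with time-like subspace `V` of the reduction of the trivial
`Spin_0(p,q)`-bundle: elements `g` of `Spin_0(p,q)` such that the frame
`(λ(g) e_1, …, λ(g) e_n)` is adapted to `V`, that is, its first `p` vectors span `V`. -/
def adaptedSpinFrames {p q : ℕ} (V : Submodule ℝ (Fin (p + q) → ℝ)) : Set (Cl p q)ˣ :=
  {g | (g : Cl p q) ∈ Spin₀ p q ∧ ∃ B ∈ SO₀ p q, Covers g B ∧ timeSpan B = V}

/-- The positive definite Hermitian bundle metric `(·,·)_ξ` induced by `ξ` on the trivial spinor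
bundle `ℝ^n × Δ_{p,q}`, given by its family of Gram operators with respect to the standard
Hermitian product: `(φ, ψ)_ξ = ⟨φ^s, ψ^s⟩` for adapted spin frames `s`, where `φ^s = g⁻¹ · φ` for
the spin frame `g`. -/
structure SpinorMetric {p q : ℕ} (ξ : Base p q → Submodule ℝ (Fin (p + q) → ℝ)) where
  gram : Base p q → (Δ p q →L[ℂ] Δ p q)
  continuous_gram : Continuous gram
  adapted : ∀ x, ∃ g ∈ adaptedSpinFrames (ξ x), ∀ φ ψ : Δ p q,
    inner ℂ φ (gram x ψ) =
      inner ℂ (act ((g⁻¹ : (Cl p q)ˣ) : Cl p q) φ) (act ((g⁻¹ : (Cl p q)ˣ) : Cl p q) ψ)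

/-- The subbundle `ξ_A(x) = span (A(x) e_1, …, A(x) e_p)` induced by `A`. -/
def inducedSubbundle {p q : ℕ} (A : Base p q → Matrix (Fin (p + q)) (Fin (p + q)) ℝ) :
    Base p q → Submodule ℝ (Fin (p + q) → ℝ) :=
  fun x => timeSpan (A x)

/-! ### The Hilbert space `L²_ξ(S)` -/

/-- Smooth compactly supported spinor fields. -/
def testSpinors (p q : ℕ) : Submodule ℂ (Base p q → Δ p q) where
  carrier := {ψ | ContDiff ℝ ∞ ψ ∧ HasCompactSupport ψ}
  add_mem' := fun ha hb => ⟨ha.1.add hb.1, ha.2.add hb.2⟩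
  zero_mem' := ⟨contDiff_const, HasCompactSupport.zero⟩
  smul_mem' := fun _ _ h => ⟨contDiff_const.smul h.1, h.2.smul_left⟩

section L2

variable {p q : ℕ} {ξ : Base p q → Submodule ℝ (Fin (p + q) → ℝ)}

/-- The space of test spinors, as a pre-Hilbert space with the product `∫ (φ, ψ)_ξ dx`. -/
def PreL2 (_h : SpinorMetric ξ) : Type := testSpinors p q

instance (h : SpinorMetric ξ) : AddCommGroup (PreL2 h) :=
  inferInstanceAs (AddCommGroup (testSpinors p q))

instance (h : SpinorMetric ξ) : Module ℂ (PreL2 h) :=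
  inferInstanceAs (Module ℂ (testSpinors p q))

/-- The product `(φ, ψ)_ξ` of two spinor fields at a point. -/
def SpinorMetric.density (h : SpinorMetric ξ) (φ ψ : Base p q → Δ p q) (x : Base p q) : ℂ :=
  inner ℂ (φ x) (h.gram x (ψ x))

theorem SpinorMetric.conj_symm (h : SpinorMetric ξ) (φ ψ : Base p q → Δ p q) (x : Base p q) :
    (starRingEnd ℂ) (h.density ψ φ x) = h.density φ ψ x := by
  obtain ⟨g, -, hg⟩ := h.adapted x
  simp only [SpinorMetric.density, hg, inner_conj_symm]

theorem SpinorMetric.re_nonneg (h : SpinorMetric ξ) (φ : Base p q → Δ p q) (x : Base p q) :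
    0 ≤ (h.density φ φ x).re := by
  obtain ⟨g, -, hg⟩ := h.adapted x
  simp only [SpinorMetric.density, hg]
  exact inner_self_nonneg (𝕜 := ℂ)

theorem SpinorMetric.definite (h : SpinorMetric ξ) (φ : Base p q → Δ p q) (x : Base p q)
    (h0 : (h.density φ φ x).re = 0) : φ x = 0 := by
  obtain ⟨g, -, hg⟩ := h.adapted x
  simp only [SpinorMetric.density, hg] at h0
  have h1 : act ((g⁻¹ : (Cl p q)ˣ) : Cl p q) (φ x) = 0 :=
    (inner_self_eq_zero (𝕜 := ℂ)).mp
      (Complex.ext h0 (inner_self_im (𝕜 := ℂ) _))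
  have h2 := act_mul ((g : Cl p q)) ((g⁻¹ : (Cl p q)ˣ) : Cl p q) (φ x)
  rw [h1, Units.mul_inv, act_one, map_zero] at h2
  exact h2

theorem SpinorMetric.continuous_density (h : SpinorMetric ξ) (φ ψ : testSpinors p q) :
    Continuous (h.density φ.1 ψ.1) := by
  have h1 : Continuous φ.1 := φ.2.1.continuous
  have h2 : Continuous ψ.1 := ψ.2.1.continuous
  exact h1.inner (h.continuous_gram.clm_apply h2)

theorem SpinorMetric.compact_density (h : SpinorMetric ξ) (φ ψ : testSpinors p q) :
    HasCompactSupport (h.density φ.1 ψ.1) := by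
  refine φ.2.2.mono ?_
  intro x hx hx0
  apply hx
  simp [SpinorMetric.density, hx0]

theorem SpinorMetric.integrable_density (h : SpinorMetric ξ) (φ ψ : testSpinors p q) :
    MeasureTheory.Integrable (h.density φ.1 ψ.1) :=
  (h.continuous_density φ ψ).integrable_of_hasCompactSupport (h.compact_density φ ψ)

/-- The `L²` product of test spinors (in Mathlib's convention antilinear in the first entry). -/
@[reducible] def SpinorMetric.core (h : SpinorMetric ξ) : InnerProductSpace.Core ℂ (PreL2 h) where
  inner φ ψ := ∫ x, h.density φ.1 ψ.1 x
  conj_inner_symm φ ψ := by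
    rw [← integral_conj]
    exact MeasureTheory.integral_congr_ae (.of_forall fun x => h.conj_symm φ.1 ψ.1 x)
  re_inner_nonneg φ := by
    have := integral_re (h.integrable_density φ φ)
    rw [← this]
    exact MeasureTheory.integral_nonneg fun x => h.re_nonneg φ.1 x
  add_left φ ψ χ := by
    rw [← MeasureTheory.integral_add (h.integrable_density φ χ) (h.integrable_density ψ χ)]
    exact MeasureTheory.integral_congr_ae (.of_forall fun x => inner_add_left _ _ _)
  smul_left φ ψ c := by
    rw [← MeasureTheory.integral_const_mul]
    exact MeasureTheory.integral_congr_ae (.of_forall fun x => inner_smul_left _ _ _)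
  definite φ h0 := by
    have h1 := integral_re (h.integrable_density φ φ)
    rw [h0, map_zero] at h1
    have hc : Continuous fun x => (h.density φ.1 φ.1 x).re :=
      Complex.continuous_re.comp (h.continuous_density φ φ)
    have h2 := (MeasureTheory.integral_eq_zero_iff_of_nonneg
      (μ := MeasureTheory.volume) (fun x => h.re_nonneg φ.1 x)
      (h.integrable_density φ φ).re).mp h1
    have h3 := (Continuous.ae_eq_iff_eq MeasureTheory.volume hc continuous_const).mp h2
    exact Subtype.ext (funext fun x => h.definite φ.1 x (congrFun h3 x))

instance (h : SpinorMetric ξ) : NormedAddCommGroup (PreL2 h) :=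
  h.core.toNormedAddCommGroup

instance (h : SpinorMetric ξ) : InnerProductSpace ℂ (PreL2 h) :=
  InnerProductSpace.ofCore h.core.toCore

/-- The Hilbert space `L²_ξ(S)`: the completion of the test spinors. -/
abbrev L2 (h : SpinorMetric ξ) : Type := UniformSpace.Completion (PreL2 h)

/-- The inclusion of the test spinors into `L²_ξ(S)`. -/
def toL2 (h : SpinorMetric ξ) : PreL2 h →ₗ[ℂ] L2 h :=
  (UniformSpace.Completion.toComplL (𝕜 := ℂ) (E := PreL2 h)).toLinearMap

theorem toL2_injective (h : SpinorMetric ξ) : Function.Injective (toL2 h) :=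
  UniformSpace.Completion.coe_injective (PreL2 h)

/-! ### The Dirac operator -/

/-- The Dirac operator `ψ ↦ ∑ κ_j e_j · ∂_j ψ` on spinor fields. -/
def diracFun (p q : ℕ) (ψ : Base p q → Δ p q) (x : Base p q) : Δ p q :=
  ∑ j : Fin (p + q), metricSign p q j •
    act (vec p q (Pi.single j 1)) (fderiv ℝ ψ x (EuclideanSpace.single j 1))

theorem diracFun_mem (ψ : testSpinors p q) : diracFun p q ψ.1 ∈ testSpinors p q := by
  constructor
  · unfold diracFun
    refine ContDiff.sum fun j _ => ContDiff.const_smul _ ?_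
    refine ((act (vec p q (Pi.single j 1))).restrictScalars ℝ).contDiff.comp ?_
    exact (ψ.2.1.fderiv_right (m := ∞) (by simp)).clm_apply contDiff_const
  · refine (ψ.2.2.fderiv ℝ).mono ?_
    intro x hx hx0
    apply hx
    simp [diracFun, hx0]

/-- The Dirac operator on test spinors. -/
def diracLin (p q : ℕ) : testSpinors p q →ₗ[ℂ] testSpinors p q where
  toFun ψ := ⟨diracFun p q ψ.1, diracFun_mem ψ⟩
  map_add' φ ψ := by
    refine Subtype.ext (funext fun x => ?_)
    have h1 : DifferentiableAt ℝ φ.1 x := (φ.2.1.differentiable (by simp)) x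
    have h2 : DifferentiableAt ℝ ψ.1 x := (ψ.2.1.differentiable (by simp)) x
    change diracFun p q (φ.1 + ψ.1) x = diracFun p q φ.1 x + diracFun p q ψ.1 x
    simp [diracFun, fderiv_add h1 h2, Finset.sum_add_distrib]
  map_smul' c ψ := by
    refine Subtype.ext (funext fun x => ?_)
    have h2 : DifferentiableAt ℝ ψ.1 x := (ψ.2.1.differentiable (by simp)) x
    change diracFun p q (c • ψ.1) x = c • diracFun p q ψ.1 x
    simp only [diracFun, fderiv_const_smul h2 c, Finset.smul_sum]
    refine Finset.sum_congr rfl fun j _ => ?_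
    rw [smul_apply, map_smul, smul_comm]

/-- The Dirac operator `D_ξ` as an unbounded operator in `L²_ξ(S)`, with the test spinors as
domain. -/
def dirac (h : SpinorMetric ξ) : L2 h →ₗ.[ℂ] L2 h where
  domain := LinearMap.range (toL2 h)
  toFun := (toL2 h).comp ((diracLin p q : PreL2 h →ₗ[ℂ] PreL2 h).comp
    (LinearEquiv.ofInjective (toL2 h) (toL2_injective h)).symm.toLinearMap)

theorem dirac_apply (h : SpinorMetric ξ) (ψ : testSpinors p q) :
    dirac h ⟨toL2 h ψ, ψ, rfl⟩ = toL2 h (diracLin p q ψ) := by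
  change toL2 h (diracLin p q ((LinearEquiv.ofInjective (toL2 h) (toL2_injective h)).symm _)) = _
  congr 2
  exact (LinearEquiv.symm_apply_eq _).mpr rfl

end L2

/-! ### Spectra of unbounded operators -/

section Spectrum

variable {H : Type*} [NormedAddCommGroup H] [InnerProductSpace ℂ H]

/-- `z I - T` on the domain of `T`. -/
def shift (T : H →ₗ.[ℂ] H) (z : ℂ) : T.domain →ₗ[ℂ] H :=
  z • T.domain.subtype - T.toFun

/-- The inverse of `z I - T`, defined on the range of `z I - T`, is a bounded operator. -/
def InverseBounded (T : H →ₗ.[ℂ] H) (z : ℂ) : Prop :=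
  ∃ C : ℝ, ∀ y : T.domain, ‖(y : H)‖ ≤ C * ‖shift T z y‖

/-- The resolvent set: `z I - T` is injective with dense range and bounded inverse. -/
def resolvent (T : H →ₗ.[ℂ] H) : Set ℂ :=
  {z | LinearMap.ker (shift T z) = ⊥ ∧ Dense (LinearMap.range (shift T z) : Set H) ∧
    InverseBounded T z}

/-- The spectrum `σ(T)`. -/
def spec (T : H →ₗ.[ℂ] H) : Set ℂ := (resolvent T)ᶜ

/-- The continuous spectrum `σ_c(T)`: `z I - T` is injective with dense range and unbounded
inverse. -/
def contSpec (T : H →ₗ.[ℂ] H) : Set ℂ :=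
  {z | LinearMap.ker (shift T z) = ⊥ ∧ Dense (LinearMap.range (shift T z) : Set H) ∧
    ¬ InverseBounded T z}

end Spectrum

end PseudoDirac

end

namespace PseudoDirac

variable {p q : ℕ}

/-! ### Half turns and their lifts to the spin group -/

/-! The proof compares `L²_ξ(S)` with the standard `L²` space and then treats a constant coefficient
operator there.

Comparison. The Hermitian adjoint of Clifford multiplication by `e_j` is `-κ_j e_j`. If `W` is the
product of the time-like basis vectors, then `g† W = W · reverse g` for every `g` in the spin group.
Hence the Gram operator `(g⁻¹)† g⁻¹` of a spin frame `g` over `B` is, up to sign, `W` times the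
reversed product of the vectors `B e_j`, `j ≤ p`. If `B` is adapted to `ξ_A(x)`, these are unit
time-like vectors in the span of the first `p` columns of `A(x)`, so a bound on `A` bounds them
uniformly. Therefore `g` and `g⁻¹` act with uniformly bounded norms (`exists_frame_bound`), and
`L²_ξ(S)` embeds into `L²` with equivalent norms (`exists_embedding`). The metric exists because
each element of `SO₀` has a lift for which the sign is `+1` (`spinLift_of_mem_SO₀`): near the
identity such a lift is a product of half turns, and connectedness does the rest.

Trivial kernel, dense range and closability. All three reduce to one fact: an `L²` field orthogonal
to the range of `z - ∑ M_j ∂_j` on test functions is zero when the `M_j` satisfy Clifford relations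
(`eq_zero_of_weak_solution`). The symbol squares to a real quadratic form, so composing with `z + ∑
M_j ∂_j` turns the condition into multiplication by `z²` minus that form on the Fourier side, which
is nonzero almost everywhere. The fact applies to the Dirac operator and to its formal adjoint `∑
γ_j ∂_j`.

Unbounded inverse. Since `p, q ≥ 1` there is a null vector, and the symbol `T` in its direction is
nilpotent and nonzero. For `T η ≠ 0` put `φ = z η + i t T η`. Then `(z - i t T) φ = z² η` stays
fixed while `‖φ‖` grows with `t`. A plane wave with amplitude `φ`, cut off at a large scale, is an
approximate eigenfunction for the arbitrary value `z` (`exists_approximate_eigenfunction`). -/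

theorem negForm_apply (v : Fin (p + q) → ℝ) :
    negForm p q v = ∑ j, -metricSign p q j * (v j * v j) := by
  simp [negForm, QuadraticMap.weightedSumSquares_apply]

theorem polar_negForm (v w : Fin (p + q) → ℝ) :
    QuadraticMap.polar (negForm p q) v w = ∑ j, 2 * -metricSign p q j * v j * w j := by
  simp only [QuadraticMap.polar, negForm_apply, ← Finset.sum_sub_distrib, Pi.add_apply]
  exact Finset.sum_congr rfl fun j _ => by ring

theorem metricSign_mul_self (j : Fin (p + q)) : metricSign p q j * metricSign p q j = 1 := by
  unfold metricSign; split_ifs <;> norm_num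

theorem negForm_single (j : Fin (p + q)) :
    negForm p q (Pi.single j 1) = -metricSign p q j := by
  rw [negForm_apply, Finset.sum_eq_single j]
  · simp
  · intro b _ hb; simp [hb]
  · simp

theorem negForm_single_ne_zero (j : Fin (p + q)) : negForm p q (Pi.single j 1) ≠ 0 := by
  rw [negForm_single]
  intro h
  have := metricSign_mul_self j
  rw [neg_eq_zero.mp h] at this
  simp at this

theorem polar_single_left (j : Fin (p + q)) (w : Fin (p + q) → ℝ) :
    QuadraticMap.polar (negForm p q) (Pi.single j 1) w = 2 * -metricSign p q j * w j := by
  rw [polar_negForm, Finset.sum_eq_single j]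
  · simp
  · intro b _ hb; simp [hb]
  · simp

/-- Linear isometries of `ℝ^{p,q}`. -/
def IsIso (B : Matrix (Fin (p + q)) (Fin (p + q)) ℝ) : Prop :=
  ∀ v, negForm p q (B *ᵥ v) = negForm p q v

theorem IsIso.mul {B B' : Matrix (Fin (p + q)) (Fin (p + q)) ℝ} (h : IsIso B) (h' : IsIso B') :
    IsIso (B * B') := fun v => by rw [← Matrix.mulVec_mulVec, h, h']

theorem IsIso.polar {B : Matrix (Fin (p + q)) (Fin (p + q)) ℝ} (h : IsIso B)
    (v w : Fin (p + q) → ℝ) :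
    QuadraticMap.polar (negForm p q) (B *ᵥ v) (B *ᵥ w) =
      QuadraticMap.polar (negForm p q) v w := by
  simp only [QuadraticMap.polar, ← Matrix.mulVec_add, h _]

theorem negForm_eq_dotProduct (v : Fin (p + q) → ℝ) :
    negForm p q v = -(v ⬝ᵥ (Matrix.diagonal (metricSign p q) *ᵥ v)) := by
  rw [negForm_apply, dotProduct, ← Finset.sum_neg_distrib]
  refine Finset.sum_congr rfl fun j _ => ?_
  rw [Matrix.mulVec_diagonal]
  ring

theorem isIso_of_mem_SO {B : Matrix (Fin (p + q)) (Fin (p + q)) ℝ} (h : B ∈ SO p q) :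
    IsIso B := by
  intro v
  rw [negForm_eq_dotProduct, negForm_eq_dotProduct]
  nth_rewrite 2 [← h.1]
  rw [Matrix.mulVec_mulVec, Matrix.dotProduct_mulVec, Matrix.vecMul_mulVec,
    ← Matrix.dotProduct_mulVec, ← Matrix.mul_assoc]

/-- The map `x ↦ 2 ⟨w, x⟩ / ⟨w, w⟩ w - x`, the negative of the reflection in the hyperplane
orthogonal to `w`. -/
noncomputable def halfTurn (w : Fin (p + q) → ℝ) : Matrix (Fin (p + q)) (Fin (p + q)) ℝ :=
  (negForm p q w)⁻¹ • Matrix.vecMulVec w (fun j => 2 * -metricSign p q j * w j) - 1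

theorem halfTurn_mulVec (w v : Fin (p + q) → ℝ) :
    halfTurn w *ᵥ v =
      ((negForm p q w)⁻¹ * QuadraticMap.polar (negForm p q) w v) • w - v := by
  rw [halfTurn, Matrix.sub_mulVec, Matrix.one_mulVec, Matrix.smul_mulVec, polar_negForm,
    Matrix.vecMulVec_mulVec]
  ext i
  simp [dotProduct, mul_assoc, mul_comm]

theorem isIso_halfTurn {w : Fin (p + q) → ℝ} (hw : negForm p q w ≠ 0) : IsIso (halfTurn w) := by
  intro v
  rw [halfTurn_mulVec, sub_eq_add_neg, QuadraticMap.map_add (negForm p q), QuadraticMap.map_neg,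
    QuadraticMap.map_smul, QuadraticMap.polar_neg_right, QuadraticMap.polar_smul_left]
  simp only [smul_eq_mul]
  field_simp
  ring

theorem halfTurn_mul_self {w : Fin (p + q) → ℝ} (hw : negForm p q w ≠ 0) :
    halfTurn w * halfTurn w = 1 := by
  refine Matrix.ext_of_mulVec_single fun j => ?_
  rw [← Matrix.mulVec_mulVec, halfTurn_mulVec w (Pi.single j 1), Matrix.mulVec_sub,
    Matrix.mulVec_smul, halfTurn_mulVec w w, halfTurn_mulVec, QuadraticMap.polar_self,
    Matrix.one_mulVec]
  have : (negForm p q w)⁻¹ * (2 • negForm p q w) = 2 := by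
    rw [nsmul_eq_mul]; field_simp; norm_num
  rw [this]
  module

theorem halfTurn_smul {c : ℝ} (hc : c ≠ 0) (w : Fin (p + q) → ℝ) :
    halfTurn (c • w) = halfTurn w := by
  refine Matrix.ext_of_mulVec_single fun j => ?_
  rw [halfTurn_mulVec, halfTurn_mulVec, QuadraticMap.map_smul, QuadraticMap.polar_smul_left,
    smul_smul]
  congr 2
  simp only [smul_eq_mul, mul_inv]
  field_simp

theorem halfTurn_eq_neg {w v : Fin (p + q) → ℝ}
    (h : QuadraticMap.polar (negForm p q) w v = 0) : halfTurn w *ᵥ v = -v := by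
  rw [halfTurn_mulVec, h]; simp

/-- The half turn about `a + v` exchanges `a` and `v`. -/
theorem halfTurn_add_mulVec {a v : Fin (p + q) → ℝ} (h : negForm p q a = negForm p q v)
    (h0 : negForm p q (a + v) ≠ 0) : halfTurn (a + v) *ᵥ v = a := by
  rw [halfTurn_mulVec, QuadraticMap.polar_add_left, QuadraticMap.polar_self]
  have : (negForm p q (a + v))⁻¹ * (QuadraticMap.polar (negForm p q) a v + 2 • negForm p q v)
      = 1 := by
    rw [QuadraticMap.map_add (negForm p q), h] at h0 ⊢
    rw [nsmul_eq_mul, inv_mul_eq_one₀ h0]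
    push_cast; ring
  rw [this]; simp

theorem halfTurn_self_mulVec {a : Fin (p + q) → ℝ} (h0 : negForm p q a ≠ 0) :
    halfTurn a *ᵥ a = a := by
  rw [halfTurn_mulVec, QuadraticMap.polar_self, nsmul_eq_mul]
  have : (negForm p q a)⁻¹ * ((2 : ℕ) * negForm p q a) = 2 := by field_simp; norm_num
  rw [this]; module

theorem continuous_negForm : Continuous (negForm p q) := by
  have : (negForm p q : (Fin (p + q) → ℝ) → ℝ) =
    fun v => ∑ j, -metricSign p q j * (v j * v j) := funext negForm_apply
  rw [this]; fun_prop

theorem continuousAt_halfTurn {w : Fin (p + q) → ℝ} (hw : negForm p q w ≠ 0) :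
    ContinuousAt (halfTurn (p := p) (q := q)) w := by
  unfold halfTurn
  refine ContinuousAt.sub (ContinuousAt.smul (continuous_negForm.continuousAt.inv₀ hw) ?_)
    continuousAt_const
  refine Continuous.continuousAt ?_
  exact Continuous.matrix_vecMulVec continuous_id (by fun_prop)

/-! ### Clifford units, the group `Spin₀` and surjectivity of its covering map -/

theorem Covers.mul {g g' : (Cl p q)ˣ} {B B' : Matrix (Fin (p + q)) (Fin (p + q)) ℝ}
    (h : Covers g B) (h' : Covers g' B') : Covers (g * g') (B * B') := by
  intro v
  rw [← Matrix.mulVec_mulVec, ← h, ← h', mul_inv_rev, Units.val_mul, Units.val_mul]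
  simp only [mul_assoc]

/-- An anisotropic vector as a unit of the Clifford algebra. -/
noncomputable def vecUnit (w : Fin (p + q) → ℝ) (hw : negForm p q w ≠ 0) : (Cl p q)ˣ where
  val := vec p q w
  inv := (negForm p q w)⁻¹ • vec p q w
  val_inv := by
    rw [mul_smul_comm, CliffordAlgebra.ι_sq_scalar, Algebra.algebraMap_eq_smul_one, smul_smul,
      inv_mul_cancel₀ hw, one_smul]
  inv_val := by
    rw [smul_mul_assoc, CliffordAlgebra.ι_sq_scalar, Algebra.algebraMap_eq_smul_one, smul_smul,
      inv_mul_cancel₀ hw, one_smul]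

theorem covers_vecUnit (w : Fin (p + q) → ℝ) (hw : negForm p q w ≠ 0) :
    Covers (vecUnit w hw) (halfTurn w) := by
  intro v
  change vec p q w * vec p q v * ((negForm p q w)⁻¹ • vec p q w) = _
  rw [mul_smul_comm, CliffordAlgebra.ι_mul_ι_mul_ι, halfTurn_mulVec, ← map_smul, smul_sub,
    smul_smul, smul_smul, inv_mul_cancel₀ hw, one_smul]

/-- `B = λ(g)` for some `g` in `Spin_0(p,q)` of spinor norm one. -/
def SpinLift (B : Matrix (Fin (p + q)) (Fin (p + q)) ℝ) : Prop :=
  ∃ g : (Cl p q)ˣ, (g : Cl p q) ∈ Spin₀ p q ∧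
    (g : Cl p q) * CliffordAlgebra.reverse (g : Cl p q) = 1 ∧ Covers g B

theorem one_mem_Spin : (1 : Cl p q) ∈ Spin p q := ⟨[], by simp, by simp, by simp⟩

theorem mul_mem_Spin {a b : Cl p q} (ha : a ∈ Spin p q) (hb : b ∈ Spin p q) :
    a * b ∈ Spin p q := by
  obtain ⟨l, hl, hl', rfl⟩ := ha
  obtain ⟨k, hk, hk', rfl⟩ := hb
  refine ⟨l ++ k, ?_, ?_, ?_⟩
  · rw [List.length_append]; exact hl.add hk
  · intro v hv
    rcases List.mem_append.mp hv with h | h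
    exacts [hl' v h, hk' v h]
  · simp

theorem Spin₀_subset : Spin₀ p q ⊆ Spin p q :=
  let _ : TopologicalSpace (Cl p q) := moduleTopology ℝ (Cl p q)
  connectedComponentIn_subset _ _

theorem one_mem_Spin₀ : (1 : Cl p q) ∈ Spin₀ p q :=
  let _ : TopologicalSpace (Cl p q) := moduleTopology ℝ (Cl p q)
  mem_connectedComponentIn one_mem_Spin

/-- The translate `a · Spin₀` is connected, lies in `Spin` and contains `a`. So it lies in the
component of `a`, which is that of the identity. Left multiplication is continuous because linear
maps are continuous for the module topology. -/
theorem mul_mem_Spin₀ {a b : Cl p q} (ha : a ∈ Spin₀ p q) (hb : b ∈ Spin₀ p q) :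
    a * b ∈ Spin₀ p q := by
  let _ : TopologicalSpace (Cl p q) := moduleTopology ℝ (Cl p q)
  have : IsModuleTopology ℝ (Cl p q) := ⟨rfl⟩
  have : ContinuousAdd (Cl p q) := IsModuleTopology.toContinuousAdd ℝ _
  have hcont : Continuous (fun x : Cl p q => a * x) :=
    IsModuleTopology.continuous_of_linearMap (LinearMap.mulLeft ℝ a)
  have hpre : IsPreconnected ((fun x : Cl p q => a * x) '' Spin₀ p q) :=
    isPreconnected_connectedComponentIn.image _ hcont.continuousOn
  have hsub : (fun x : Cl p q => a * x) '' Spin₀ p q ⊆ Spin p q := by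
    rintro _ ⟨x, hx, rfl⟩
    exact mul_mem_Spin (Spin₀_subset ha) (Spin₀_subset hx)
  have h1 : a ∈ (fun x : Cl p q => a * x) '' Spin₀ p q := ⟨1, one_mem_Spin₀, mul_one a⟩
  have h2 := hpre.subset_connectedComponentIn h1 hsub
  have h3 : connectedComponentIn (Spin p q) a = Spin₀ p q :=
    (connectedComponentIn_eq ha).symm
  rw [h3] at h2
  exact h2 ⟨b, hb, rfl⟩

theorem SpinLift.one : SpinLift (1 : Matrix (Fin (p + q)) (Fin (p + q)) ℝ) :=
  ⟨1, one_mem_Spin₀, by simp, fun v => by simp⟩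

theorem SpinLift.mul {B B' : Matrix (Fin (p + q)) (Fin (p + q)) ℝ}
    (h : SpinLift B) (h' : SpinLift B') : SpinLift (B * B') := by
  obtain ⟨g, h1, h2, h3⟩ := h
  obtain ⟨g', h1', h2', h3'⟩ := h'
  refine ⟨g * g', mul_mem_Spin₀ h1 h1', ?_, h3.mul h3'⟩
  rw [Units.val_mul, CliffordAlgebra.reverse.map_mul, mul_assoc, ← mul_assoc (g' : Cl p q), h2',
    one_mul, h2]

/-- A product of two vectors that can be joined to `e_k` without becoming isotropic. -/
theorem SpinLift.halfTurn_mul (k : Fin (p + q)) {v : Fin (p + q) → ℝ}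
    (hv : negForm p q v = negForm p q (Pi.single k 1)) (hk : 0 ≤ v k) :
    SpinLift (halfTurn (Pi.single k 1 + v) * halfTurn (Pi.single k 1)) := by
  set a : Fin (p + q) → ℝ := Pi.single k 1 with ha
  set s : ℝ := negForm p q a with hs
  have hss : s * s = 1 := by
    rw [hs, ha, negForm_single]; simpa using metricSign_mul_self k
  have hs0 : s ≠ 0 := negForm_single_ne_zero k
  have hpol : QuadraticMap.polar (negForm p q) a v = 2 * s * v k := by
    rw [polar_single_left, hs, ha, negForm_single]
  have hN : ∀ t : ℝ, negForm p q (a + t • v) = s * (1 + t ^ 2 + 2 * t * v k) := by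
    intro t
    rw [QuadraticMap.map_add (negForm p q), QuadraticMap.map_smul, QuadraticMap.polar_smul_right,
      hpol, hv]
    simp only [smul_eq_mul, ← hs]; ring
  have hpos : ∀ t : ℝ, 0 ≤ t → 0 < 1 + t ^ 2 + 2 * t * v k := fun t ht => by positivity
  -- `r t` normalises `a + t v` to have the same form value `s = ± 1` as `a`, which is possible
  -- because `v k ≥ 0` keeps the segment anisotropic. The extra factor `s` makes the path `(r t • (a
  -- + t • v)) · a` start at `s • a · a = s² = 1`, hence stay in the identity component.
  let r : ℝ → ℝ := fun t => s * (Real.sqrt (1 + t ^ 2 + 2 * t * v k))⁻¹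
  have hr : ∀ t, 0 ≤ t → r t * r t * (1 + t ^ 2 + 2 * t * v k) = 1 := by
    intro t ht
    have h1 := Real.mul_self_sqrt (hpos t ht).le
    have h2 := (Real.sqrt_pos.mpr (hpos t ht)).ne'
    simp only [r]
    nth_rewrite 3 [← h1]
    field_simp
    nlinarith [hss]
  have hNr : ∀ t, 0 ≤ t → negForm p q (r t • (a + t • v)) = s := by
    intro t ht
    rw [QuadraticMap.map_smul, hN, smul_eq_mul]
    linear_combination s * hr t ht
  have hs1 : s = 1 ∨ s = -1 := by
    have : (s - 1) * (s + 1) = 0 := by linear_combination hss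
    rcases mul_eq_zero.mp this with h | h
    · left; linarith
    · right; linarith
  have hr1 : r 1 ≠ 0 := fun h => by simpa [h] using hr 1 zero_le_one
  have hu0 : negForm p q (r 1 • (a + v)) ≠ 0 := by
    have := hNr 1 zero_le_one
    rw [one_smul] at this
    rw [this]; exact hs0
  refine ⟨vecUnit (r 1 • (a + v)) hu0 * vecUnit a hs0, ?_, ?_, ?_⟩
  · let _ : TopologicalSpace (Cl p q) := moduleTopology ℝ (Cl p q)
    have : IsModuleTopology ℝ (Cl p q) := ⟨rfl⟩
    have : ContinuousAdd (Cl p q) := IsModuleTopology.toContinuousAdd ℝ _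
    let L : (Fin (p + q) → ℝ) →ₗ[ℝ] Cl p q := (LinearMap.mulRight ℝ (vec p q a)).comp (vec p q)
    have hL : Continuous L := IsModuleTopology.continuous_of_linearMap L
    have hrc : ContinuousOn r (Set.Icc 0 1) := by
      refine continuousOn_const.mul (ContinuousOn.inv₀ (by fun_prop) ?_)
      intro t ht
      exact (Real.sqrt_pos.mpr (hpos t ht.1)).ne'
    have hc : ContinuousOn (fun t : ℝ => L (r t • (a + t • v))) (Set.Icc 0 1) :=
      hL.comp_continuousOn (hrc.smul (by fun_prop))
    have hpre := isPreconnected_Icc.image _ hc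
    have h1 : (1 : Cl p q) ∈ (fun t : ℝ => L (r t • (a + t • v))) '' Set.Icc 0 1 := by
      refine ⟨0, by simp, ?_⟩
      have : r 0 = s := by simp [r]
      simp only [this, zero_smul, add_zero, L, LinearMap.comp_apply, LinearMap.mulRight_apply,
        map_smul]
      rw [CliffordAlgebra.ι_sq_scalar, Algebra.algebraMap_eq_smul_one, smul_smul,
        ← hs, hss, one_smul]
    have hsub : (fun t : ℝ => L (r t • (a + t • v))) '' Set.Icc 0 1 ⊆ Spin p q := by
      rintro _ ⟨t, ht, rfl⟩
      refine ⟨[r t • (a + t • v), a], by simp, ?_, by simp [L]⟩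
      intro w hw
      simp only [List.mem_cons, List.not_mem_nil, or_false] at hw
      rcases hw with rfl | rfl
      · rw [hNr t ht.1]; exact hs1
      · exact hs1
    refine hpre.subset_connectedComponentIn h1 hsub ⟨1, by simp, ?_⟩
    simp [L, vecUnit]
  · have h := hNr 1 zero_le_one
    rw [one_smul] at h
    change vec p q _ * vec p q a * CliffordAlgebra.reverse (vec p q _ * vec p q a) = 1
    rw [CliffordAlgebra.reverse.map_mul, CliffordAlgebra.reverse_ι, CliffordAlgebra.reverse_ι,
      mul_assoc, ← mul_assoc (vec p q a), CliffordAlgebra.ι_sq_scalar,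
      Algebra.left_comm, CliffordAlgebra.ι_sq_scalar, h, ← map_mul, ← hs, hss, map_one]
  · have := (covers_vecUnit _ hu0).mul (covers_vecUnit a hs0)
    rwa [halfTurn_smul hr1] at this

/-- Isometries near the identity that fix the first `n - d` basis vectors have spin lifts. -/
theorem eventually_spinLift (d : ℕ) (hd : d ≤ p + q) :
    ∀ᶠ B in nhds (1 : Matrix (Fin (p + q)) (Fin (p + q)) ℝ), IsIso B →
      (∀ j : Fin (p + q), j.val + d < p + q → B *ᵥ Pi.single j 1 = Pi.single j 1) →
        SpinLift B := by
  induction d with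
  | zero =>
    refine Filter.Eventually.of_forall fun B _ hB => ?_
    have : B = 1 := Matrix.ext_of_mulVec_single fun j => by
      rw [hB j (by simp), Matrix.one_mulVec]
    rw [this]; exact SpinLift.one
  | succ d ih =>
    have ih := ih (by omega)
    -- The first index whose basis vector is not assumed to be fixed.
    let k : Fin (p + q) := ⟨p + q - (d + 1), by omega⟩
    set a : Fin (p + q) → ℝ := Pi.single k 1 with ha
    have ha0 : negForm p q a ≠ 0 := negForm_single_ne_zero k
    have haa : a + (1 : Matrix (Fin (p + q)) (Fin (p + q)) ℝ) *ᵥ a = (2 : ℝ) • a := by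
      rw [Matrix.one_mulVec, two_smul]
    -- The induction hypothesis is applied to the product of `B` with two half turns. The turn about
    -- `a + B a` sends `B a` to `a`, and the turn about `a` keeps it there, so one more basis vector
    -- is fixed. At `B = 1` the product is `1`, so by continuity it stays in the neighbourhood
    -- supplied by the induction.
    have hcont : ContinuousAt (fun B : Matrix (Fin (p + q)) (Fin (p + q)) ℝ =>
        halfTurn a * halfTurn (a + B *ᵥ a) * B) 1 := by
      refine ContinuousAt.mul (ContinuousAt.mul continuousAt_const ?_) continuousAt_id
      refine ContinuousAt.comp (g := halfTurn) (continuousAt_halfTurn ?_) ?_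
      · rw [haa, QuadraticMap.map_smul]
        simpa using ha0
      · exact (continuous_const.add (continuous_id.matrix_mulVec continuous_const)).continuousAt
    have hval : halfTurn a * halfTurn (a + (1 : Matrix (Fin (p + q)) (Fin (p + q)) ℝ) *ᵥ a) * 1
        = 1 := by
      rw [haa, halfTurn_smul two_ne_zero, halfTurn_mul_self ha0, mul_one]
    have hT : Filter.Tendsto (fun B : Matrix (Fin (p + q)) (Fin (p + q)) ℝ =>
        halfTurn a * halfTurn (a + B *ᵥ a) * B) (nhds 1) (nhds 1) := by
      have := hcont.tendsto
      rwa [hval] at this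
    have hk : ∀ᶠ B in nhds (1 : Matrix (Fin (p + q)) (Fin (p + q)) ℝ), 0 < (B *ᵥ a) k := by
      refine ContinuousAt.eventually_lt (f := fun _ => (0 : ℝ)) continuousAt_const
        (g := fun B : Matrix (Fin (p + q)) (Fin (p + q)) ℝ => (B *ᵥ a) k) ?_ (by simp [ha])
      exact ((continuous_apply k).comp
        (continuous_id.matrix_mulVec continuous_const)).continuousAt
    filter_upwards [hT.eventually ih, hk] with B hB hBk hiso hfix
    have hNv : negForm p q (B *ᵥ a) = negForm p q a := hiso a
    have hN : negForm p q (a + B *ᵥ a) ≠ 0 := by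
      rw [QuadraticMap.map_add (negForm p q), hNv, ha, polar_single_left, negForm_single, ← ha]
      have : -metricSign p q k + -metricSign p q k + 2 * -metricSign p q k * (B *ᵥ a) k
        = 2 * -metricSign p q k * (1 + (B *ᵥ a) k) := by ring
      rw [this]
      have h0 := negForm_single_ne_zero k
      rw [negForm_single] at h0
      exact mul_ne_zero (mul_ne_zero two_ne_zero h0) (by positivity)
    have hlift := hB (((isIso_halfTurn ha0).mul (isIso_halfTurn hN)).mul hiso) ?_
    · have := (SpinLift.halfTurn_mul k hNv hBk.le).mul hlift
      rw [← ha] at this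
      have hprod : halfTurn (a + B *ᵥ a) * halfTurn a *
          (halfTurn a * halfTurn (a + B *ᵥ a) * B) = B := by
        calc _ = halfTurn (a + B *ᵥ a) * (halfTurn a * halfTurn a) * halfTurn (a + B *ᵥ a) * B := by
              simp only [mul_assoc]
          _ = B := by rw [halfTurn_mul_self ha0, mul_one, halfTurn_mul_self hN, one_mul]
      rwa [hprod] at this
    · intro j hj
      rw [← Matrix.mulVec_mulVec, ← Matrix.mulVec_mulVec]
      by_cases hjk : j = k
      · subst hjk
        rw [← ha, halfTurn_add_mulVec hNv.symm hN, halfTurn_self_mulVec ha0]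
      · have hjlt : j.val + (d + 1) < p + q := by
          have : j.val ≠ p + q - (d + 1) := fun h => hjk (Fin.ext h)
          omega
        have hBj := hfix j hjlt
        have hpol : QuadraticMap.polar (negForm p q) a (Pi.single j 1) = 0 := by
          rw [ha, polar_single_left]
          simp [Ne.symm hjk]
        have hpol2 : QuadraticMap.polar (negForm p q) (B *ᵥ a) (Pi.single j 1) = 0 := by
          rw [← hBj, hiso.polar, hpol]
        have hpol3 : QuadraticMap.polar (negForm p q) (a + B *ᵥ a) (Pi.single j 1) = 0 := by
          rw [QuadraticMap.polar_add_left, hpol, hpol2, add_zero]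
        -- An already fixed `e_j` is orthogonal to both axes, so it is negated twice.
        rw [hBj, halfTurn_eq_neg hpol3, Matrix.mulVec_neg, halfTurn_eq_neg hpol, neg_neg]

theorem one_mem_SO : (1 : Matrix (Fin (p + q)) (Fin (p + q)) ℝ) ∈ SO p q := by simp [SO]

theorem inv_mul_isIso {B B' : Matrix (Fin (p + q)) (Fin (p + q)) ℝ} (h : B ∈ SO p q)
    (h' : B' ∈ SO p q) : IsIso (B⁻¹ * B') := by
  refine IsIso.mul (fun v => ?_) (isIso_of_mem_SO h')
  have := isIso_of_mem_SO h (B⁻¹ *ᵥ v)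
  rwa [Matrix.mulVec_mulVec, Matrix.mul_nonsing_inv _ (by rw [h.2]; exact isUnit_one),
    Matrix.one_mulVec, eq_comm] at this

/-- The covering `Spin_0(p,q) → SO_0(p,q)` is surjective. -/
theorem spinLift_of_mem_SO₀ {B : Matrix (Fin (p + q)) (Fin (p + q)) ℝ} (hB : B ∈ SO₀ p q) :
    SpinLift B := by
  have hpre : IsPreconnected (SO₀ p q) := isPreconnected_connectedComponentIn
  have hsub : SO₀ p q ⊆ SO p q := connectedComponentIn_subset _ _
  have hnear : ∀ᶠ C in nhds (1 : Matrix (Fin (p + q)) (Fin (p + q)) ℝ), IsIso C → SpinLift C := by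
    filter_upwards [eventually_spinLift (p + q) le_rfl] with C hC hiso
    exact hC hiso fun j hj => absurd hj (by omega)
  have hdet : ∀ {C : Matrix (Fin (p + q)) (Fin (p + q)) ℝ}, C ∈ SO p q → IsUnit C.det :=
    fun h => by rw [h.2]; exact isUnit_one
  -- On a preconnected set, a transitive relation that holds in both directions between each point
  -- and its neighbours holds between any two points. It is used from the identity to `B`.
  have key := hpre.induction₂' (fun C C' => SpinLift (C⁻¹ * C')) ?_ ?_
    (mem_connectedComponentIn one_mem_SO) hB
  · simpa using key
  · intro C hC
    have h1 : Filter.Tendsto (fun C' => C⁻¹ * C') (nhds C) (nhds 1) := by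
      have : ContinuousAt (fun C' => C⁻¹ * C') C :=
        (continuous_const.mul continuous_id).continuousAt
      have h := this.tendsto
      rwa [Matrix.nonsing_inv_mul _ (hdet (hsub hC))] at h
    have h2 : Filter.Tendsto (fun C' => C'⁻¹ * C) (nhds C) (nhds 1) := by
      have : ContinuousAt (fun C' : Matrix (Fin (p + q)) (Fin (p + q)) ℝ => C'⁻¹ * C) C := by
        refine ContinuousAt.mul (f := fun C' : Matrix (Fin (p + q)) (Fin (p + q)) ℝ => C'⁻¹)
          (continuousAt_matrix_inv _ ?_) continuousAt_const
        rw [(hsub hC).2]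
        exact NormedRing.inverse_continuousAt 1
      have h := this.tendsto
      rwa [Matrix.nonsing_inv_mul _ (hdet (hsub hC))] at h
    filter_upwards [mem_nhdsWithin_of_mem_nhds (h1.eventually hnear),
      mem_nhdsWithin_of_mem_nhds (h2.eventually hnear), self_mem_nhdsWithin] with C' ha hb hC'
    exact ⟨ha (inv_mul_isIso (hsub hC) (hsub hC')), hb (inv_mul_isIso (hsub hC') (hsub hC))⟩
  · intro C C' C'' _ hC' _ h h'
    have := h.mul h'
    rwa [mul_assoc, ← mul_assoc C', Matrix.mul_nonsing_inv _ (hdet (hsub hC')), one_mul] at this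

/-! ### Adjoints of Clifford multiplication -/

theorem act_mul_eq (a b : Cl p q) : act (a * b) = act a * act b := by simp [act]

theorem act_one_eq : act (1 : Cl p q) = 1 := by simp [act]

theorem act_add (a b : Cl p q) : act (a + b) = act a + act b := by simp [act]

theorem act_smul (c : ℝ) (a : Cl p q) : act (c • a) = (c : ℂ) • act a := by
  rw [act, map_smul, ← Complex.coe_smul, map_smul, act]

theorem ofReal_smul_clm (c : ℝ) (T : Δ p q →L[ℂ] Δ p q) : (c : ℂ) • T = c • T :=
  ContinuousLinearMap.ext fun φ => Complex.coe_smul c (T φ)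

/-- Clifford multiplication by vectors, as a linear map. -/
noncomputable def actVec (p q : ℕ) : (Fin (p + q) → ℝ) →ₗ[ℝ] (Δ p q →L[ℂ] Δ p q) where
  toFun v := act (vec p q v)
  map_add' v w := by rw [map_add, act_add]
  map_smul' c v := by rw [map_smul, act_smul, RingHom.id_apply, ofReal_smul_clm]

theorem kron_conjTranspose {m : ℕ} (M : Fin m → Matrix (Fin 2) (Fin 2) ℂ) :
    (kron M)ᴴ = kron (fun k => (M k)ᴴ) := by
  ext s t
  simp [kron, Matrix.conjTranspose_apply]

theorem matU₁_conjTranspose : matU₁ᴴ = -matU₁ := by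
  ext i j; fin_cases i <;> fin_cases j <;> simp [matU₁, Matrix.conjTranspose_apply]

theorem matU₂_conjTranspose : matU₂ᴴ = -matU₂ := by
  ext i j; fin_cases i <;> fin_cases j <;> simp [matU₂, Matrix.conjTranspose_apply]

theorem matT_conjTranspose : matTᴴ = matT := by
  ext i j; fin_cases i <;> fin_cases j <;> simp [matT, Matrix.conjTranspose_apply]

theorem factor_conjTranspose (j k : ℕ) :
    (factor j k)ᴴ = (if k = j / 2 then (-1 : ℂ) else 1) • factor j k := by
  unfold factor
  split_ifs <;>
    first | omega | simp [matU₁_conjTranspose, matU₂_conjTranspose, matT_conjTranspose]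

theorem star_tau (j : Fin (p + q)) :
    star (tau p q j) = ((metricSign p q j : ℝ) : ℂ) * tau p q j := by
  unfold tau metricSign; split_ifs <;> simp

theorem gammaMat_conjTranspose (j : Fin (p + q)) :
    (gammaMat p q j)ᴴ = ((-metricSign p q j : ℝ) : ℂ) • gammaMat p q j := by
  unfold gammaMat
  split_ifs with h
  · rw [Matrix.conjTranspose_smul, kron_conjTranspose]
    simp only [factor_conjTranspose]
    rw [kron_smul, prod_sign h, star_tau, smul_smul, smul_smul]
    push_cast; congr 1; ring
  · rw [Matrix.conjTranspose_smul, kron_conjTranspose]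
    simp only [matT_conjTranspose]
    rw [star_mul', star_tau, smul_smul]
    push_cast; congr 1
    simp; ring

theorem spinRep_vec (v : Fin (p + q) → ℝ) : spinRep p q (vec p q v) = gammaLin p q v := by
  simp [spinRep]

theorem spinRep_single (j : Fin (p + q)) :
    spinRep p q (vec p q (Pi.single j 1)) = gammaMat p q j := by
  rw [spinRep_vec, gammaLin, Fintype.linearCombination_apply_single, one_smul]

theorem star_act_single (j : Fin (p + q)) :
    star (act (vec p q (Pi.single j 1))) =
      ((-metricSign p q j : ℝ) : ℂ) • act (vec p q (Pi.single j 1)) := by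
  rw [act, ← map_star, spinRep_single, Matrix.star_eq_conjTranspose, gammaMat_conjTranspose,
    map_smul]

theorem vec_anticomm {i j : Fin (p + q)} (h : i ≠ j) :
    vec p q (Pi.single i 1) * vec p q (Pi.single j 1) =
      -(vec p q (Pi.single j 1) * vec p q (Pi.single i 1)) := by
  have := CliffordAlgebra.ι_mul_ι_add_swap (Q := negForm p q) (Pi.single i 1) (Pi.single j 1)
  rw [polar_single_left] at this
  simp only [ne_eq, h, not_false_eq_true, Pi.single_eq_of_ne, mul_zero, map_zero] at this
  exact eq_neg_of_add_eq_zero_left this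

/-- The Clifford product of the vectors `B e_j` over a list of indices. -/
noncomputable def frameProd (B : Matrix (Fin (p + q)) (Fin (p + q)) ℝ)
    (l : List (Fin (p + q))) : Cl p q :=
  (l.map fun j => vec p q (B *ᵥ Pi.single j 1)).prod

/-- The indices of the time-like basis vectors. -/
def timeList (p q : ℕ) : List (Fin (p + q)) :=
  (List.finRange (p + q)).filter fun j => j.val < p

theorem mem_timeList {j : Fin (p + q)} : j ∈ timeList p q ↔ j.val < p := by simp [timeList]

theorem nodup_timeList : (timeList p q).Nodup := (List.nodup_finRange _).filter _

/-- Moving `e_j` through the product costs a sign for every factor different from `e_j`. Without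
repetitions at most one factor equals `e_j`, and this one costs no sign. -/
theorem vec_mul_frameProd (j : Fin (p + q)) {l : List (Fin (p + q))} (hl : l.Nodup) :
    vec p q (Pi.single j 1) * frameProd 1 l =
      ((-1) ^ l.length * (if j ∈ l then -1 else 1) : ℝ) •
        (frameProd 1 l * vec p q (Pi.single j 1)) := by
  induction l with
  | nil => simp [frameProd]
  | cons i l ih =>
    have hi := List.nodup_cons.mp hl
    have ih := ih hi.2
    have hcons : frameProd (1 : Matrix (Fin (p + q)) (Fin (p + q)) ℝ) (i :: l) =
        vec p q (Pi.single i 1) * frameProd 1 l := by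
      rw [frameProd, List.map_cons, List.prod_cons, Matrix.one_mulVec, frameProd]
    rw [hcons]
    by_cases hij : j = i
    · subst hij
      rw [if_neg hi.1, mul_one] at ih
      rw [if_pos List.mem_cons_self]
      nth_rewrite 1 [ih]
      rw [mul_smul_comm, List.length_cons, pow_succ, mul_assoc]
      simp [mul_assoc]
    · have : (j ∈ i :: l) ↔ j ∈ l := by simp [hij]
      rw [← mul_assoc, vec_anticomm hij, neg_mul, mul_assoc, ih, mul_smul_comm, ← mul_assoc,
        ← neg_smul]
      simp only [this, List.length_cons, pow_succ]
      congr 1; ring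

/-- The Clifford product of the time-like basis vectors. -/
noncomputable def timeElt (p q : ℕ) : Cl p q := frameProd 1 (timeList p q)

/-- The adjoint of `e_j` contributes `-κ_j`, and passing `e_j` through the time-like product
contributes `κ_j` times a sign common to all `j`. As `κ_j² = 1`, the total sign does not depend on
`j`, and the relation extends linearly to all vectors. -/
theorem star_act_vec_mul (v : Fin (p + q) → ℝ) :
    star (act (vec p q v)) * act (timeElt p q) =
      ((-(-1) ^ (timeList p q).length : ℝ) : ℂ) • (act (timeElt p q) * act (vec p q v)) := by
  have hv : v = ∑ j, v j • Pi.single j (1 : ℝ) := by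
    ext k; simp [Finset.sum_apply, Pi.single_apply]
  have hact : act (vec p q v) = ∑ j, (v j : ℂ) • act (vec p q (Pi.single j 1)) := by
    change actVec p q v = _
    nth_rewrite 1 [hv]
    rw [map_sum]
    refine Finset.sum_congr rfl fun j _ => ?_
    rw [map_smul, ofReal_smul_clm]
    rfl
  have hstar := star_sum Finset.univ
    fun j => (v j : ℂ) • act (vec p q (Pi.single j 1))
  rw [hact, hstar, Finset.sum_mul, Finset.mul_sum, Finset.smul_sum]
  refine Finset.sum_congr rfl fun j _ => ?_
  rw [star_smul, star_act_single, RCLike.star_def, Complex.conj_ofReal, smul_mul_assoc,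
    smul_mul_assoc, ← act_mul_eq,
    timeElt, vec_mul_frameProd j nodup_timeList, act_smul, act_mul_eq, mul_smul_comm, smul_smul,
    smul_smul, smul_smul, ← Complex.ofReal_mul, ← Complex.ofReal_mul, ← Complex.ofReal_mul]
  congr 2
  have : (if j ∈ timeList p q then (-1 : ℝ) else 1) = metricSign p q j := by
    simp [mem_timeList, metricSign]
  rw [this]
  linear_combination (-v j * (-1) ^ (timeList p q).length) * metricSign_mul_self j

theorem star_act_list_mul (l : List (Fin (p + q) → ℝ)) :
    star (act (l.map (vec p q)).prod) * act (timeElt p q) =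
      (((-(-1) ^ (timeList p q).length : ℝ) ^ l.length : ℝ) : ℂ) •
        (act (timeElt p q) * act (CliffordAlgebra.reverse (l.map (vec p q)).prod)) := by
  induction l with
  | nil => simp [act_one_eq]
  | cons v l ih =>
    rw [List.map_cons, List.prod_cons, act_mul_eq, star_mul, mul_assoc, star_act_vec_mul,
      mul_smul_comm, ← mul_assoc, ih, CliffordAlgebra.reverse.map_mul, CliffordAlgebra.reverse_ι,
      act_mul_eq, smul_mul_assoc, smul_smul, ← Complex.ofReal_mul, List.length_cons, pow_succ',
      mul_assoc]

/-- Each vector factor brings the same sign, and elements of `Spin` have an even number of factors.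
Reversion appears because taking adjoints reverses the order of products. -/
theorem star_act_mul_of_mem_Spin {g : Cl p q} (hg : g ∈ Spin p q) :
    star (act g) * act (timeElt p q) = act (timeElt p q) * act (CliffordAlgebra.reverse g) := by
  obtain ⟨l, hl, -, rfl⟩ := hg
  rw [star_act_list_mul]
  have : ((-(-1) ^ (timeList p q).length : ℝ) ^ l.length) = 1 := by
    obtain ⟨k, hk⟩ := hl
    rw [hk, pow_add, ← mul_pow, neg_mul_neg, ← mul_pow]
    norm_num
  rw [this, Complex.ofReal_one, one_smul]

/-! ### Reversion, the spinor norm and Gram operators -/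

theorem list_mul_reverse (l : List (Fin (p + q) → ℝ)) :
    (l.map (vec p q)).prod * CliffordAlgebra.reverse (l.map (vec p q)).prod =
      algebraMap ℝ (Cl p q) (l.map (negForm p q)).prod := by
  induction l with
  | nil => simp
  | cons v l ih =>
    rw [List.map_cons, List.prod_cons, CliffordAlgebra.reverse.map_mul, CliffordAlgebra.reverse_ι,
      mul_assoc, ← mul_assoc (l.map (vec p q)).prod, ih, Algebra.left_comm,
      CliffordAlgebra.ι_sq_scalar, ← map_mul, List.map_cons, List.prod_cons, mul_comm]

theorem reverse_mem_Spin {g : Cl p q} (hg : g ∈ Spin p q) :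
    CliffordAlgebra.reverse g ∈ Spin p q := by
  obtain ⟨l, hl, hl', rfl⟩ := hg
  refine ⟨l.reverse, by simpa using hl, by simpa using hl', ?_⟩
  rw [CliffordAlgebra.reverse_prod_map_ι, List.map_reverse]

/-- The sign `c` is the product of the form values of the factors. It need not be identified: the
norm estimates for arbitrary adapted frames only use that its modulus is one. -/
theorem spinorNorm_of_mem_Spin {g : Cl p q} (hg : g ∈ Spin p q) :
    ∃ c : ℝ, c * c = 1 ∧ g * CliffordAlgebra.reverse g = algebraMap ℝ (Cl p q) c := by
  obtain ⟨l, -, hl, rfl⟩ := hg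
  refine ⟨_, ?_, list_mul_reverse l⟩
  induction l with
  | nil => simp
  | cons v l ih =>
    rw [List.map_cons, List.prod_cons, mul_mul_mul_comm, ih fun w hw => hl w (by simp [hw])]
    rcases hl v (by simp) with h | h <;> rw [h] <;> norm_num

theorem frameProd_eq (B : Matrix (Fin (p + q)) (Fin (p + q)) ℝ) (l : List (Fin (p + q))) :
    frameProd B l = ((l.map fun j => B *ᵥ Pi.single j 1).map (vec p q)).prod := by
  rw [frameProd, List.map_map]; rfl

theorem reverse_frameProd (B : Matrix (Fin (p + q)) (Fin (p + q)) ℝ) (l : List (Fin (p + q))) :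
    CliffordAlgebra.reverse (frameProd B l) = frameProd B l.reverse := by
  rw [frameProd_eq, CliffordAlgebra.reverse_prod_map_ι, frameProd, List.map_reverse, List.map_map]
  rfl

theorem timeElt_mul_reverse : timeElt p q * CliffordAlgebra.reverse (timeElt p q) = 1 := by
  rw [timeElt, frameProd_eq, list_mul_reverse]
  have : (((timeList p q).map fun j =>
      (1 : Matrix (Fin (p + q)) (Fin (p + q)) ℝ) *ᵥ Pi.single j 1).map (negForm p q)).prod = 1 := by
    refine List.prod_eq_one fun x hx => ?_
    simp only [List.map_map, List.mem_map, Function.comp_apply, Matrix.one_mulVec] at hx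
    obtain ⟨j, hj, rfl⟩ := hx
    rw [negForm_single, metricSign, if_pos (mem_timeList.mp hj), neg_neg]
  rw [this, map_one]

theorem conj_frameProd {g : (Cl p q)ˣ} {B : Matrix (Fin (p + q)) (Fin (p + q)) ℝ}
    (h : Covers g B) (l : List (Fin (p + q))) :
    (g : Cl p q) * frameProd 1 l * ((g⁻¹ : (Cl p q)ˣ) : Cl p q) = frameProd B l := by
  induction l with
  | nil => simp [frameProd]
  | cons i l ih =>
    have hcons : ∀ C : Matrix (Fin (p + q)) (Fin (p + q)) ℝ, frameProd C (i :: l) =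
        vec p q (C *ᵥ Pi.single i 1) * frameProd C l := fun C => by simp [frameProd]
    rw [hcons, hcons, ← h, ← ih, Matrix.one_mulVec]
    simp only [mul_assoc, Units.inv_mul_cancel_left]

theorem inv_eq_of_mul_reverse {g : (Cl p q)ˣ} {c : ℝ} (hc : c * c = 1)
    (h : (g : Cl p q) * CliffordAlgebra.reverse (g : Cl p q) = algebraMap ℝ (Cl p q) c) :
    ((g⁻¹ : (Cl p q)ˣ) : Cl p q) = c • CliffordAlgebra.reverse (g : Cl p q) := by
  refine Units.inv_eq_of_mul_eq_one_right ?_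
  rw [mul_smul_comm, h, Algebra.algebraMap_eq_smul_one, smul_smul, hc, one_smul]

/-- The Gram operator of an adapted spin frame depends only on the time-like frame vectors. -/
theorem star_act_inv_mul {g : (Cl p q)ˣ} {B : Matrix (Fin (p + q)) (Fin (p + q)) ℝ} {c : ℝ}
    (hg : (g : Cl p q) ∈ Spin p q) (hB : Covers g B) (hc : c * c = 1)
    (h : (g : Cl p q) * CliffordAlgebra.reverse (g : Cl p q) = algebraMap ℝ (Cl p q) c) :
    star (act ((g⁻¹ : (Cl p q)ˣ) : Cl p q)) * act ((g⁻¹ : (Cl p q)ˣ) : Cl p q) =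
      (c : ℂ) • (act (timeElt p q) * act (frameProd B (timeList p q).reverse)) := by
  have hW : act (timeElt p q) * act (CliffordAlgebra.reverse (timeElt p q)) = 1 := by
    rw [← act_mul_eq, timeElt_mul_reverse, act_one_eq]
  have h1 := star_act_mul_of_mem_Spin (reverse_mem_Spin hg)
  rw [CliffordAlgebra.reverse_reverse] at h1
  have h2 : star (act ((g⁻¹ : (Cl p q)ˣ) : Cl p q)) =
      (c : ℂ) • (act (timeElt p q) * act (g : Cl p q) *
        act (CliffordAlgebra.reverse (timeElt p q))) := by
    rw [← h1, mul_assoc, hW, mul_one, inv_eq_of_mul_reverse hc h, act_smul, star_smul,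
      RCLike.star_def, Complex.conj_ofReal]
  rw [h2, smul_mul_assoc, ← conj_frameProd hB, act_mul_eq, act_mul_eq, timeElt, reverse_frameProd]
  simp only [mul_assoc]

/-- Counterpart of `star_act_inv_mul` for `g` in place of `g⁻¹`; together they bound both operator
norms by the time-like frame. -/
theorem act_mul_star {g : (Cl p q)ˣ} {B : Matrix (Fin (p + q)) (Fin (p + q)) ℝ} {c : ℝ}
    (hg : (g : Cl p q) ∈ Spin p q) (hB : Covers g B) (hc : c * c = 1)
    (h : (g : Cl p q) * CliffordAlgebra.reverse (g : Cl p q) = algebraMap ℝ (Cl p q) c) :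
    act (g : Cl p q) * star (act (g : Cl p q)) =
      (c : ℂ) • (act (frameProd B (timeList p q)) * act (frameProd 1 (timeList p q).reverse)) := by
  have hW : act (timeElt p q) * act (CliffordAlgebra.reverse (timeElt p q)) = 1 := by
    rw [← act_mul_eq, timeElt_mul_reverse, act_one_eq]
  have h1 := star_act_mul_of_mem_Spin hg
  have h3 : CliffordAlgebra.reverse (g : Cl p q) = c • ((g⁻¹ : (Cl p q)ˣ) : Cl p q) := by
    rw [inv_eq_of_mul_reverse hc h, smul_smul, hc, one_smul]
  have h2 : star (act (g : Cl p q)) = act (timeElt p q) * act (CliffordAlgebra.reverse (g : Cl p q))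
      * act (CliffordAlgebra.reverse (timeElt p q)) := by
    rw [← h1, mul_assoc, hW, mul_one]
  rw [h2, h3, ← conj_frameProd hB, act_smul, timeElt, reverse_frameProd, act_mul_eq, act_mul_eq,
    mul_smul_comm, smul_mul_assoc, mul_smul_comm]
  simp only [mul_assoc]

theorem continuous_actVec : Continuous (actVec p q) :=
  LinearMap.continuous_of_finiteDimensional _

theorem act_frameProd (B : Matrix (Fin (p + q)) (Fin (p + q)) ℝ) (l : List (Fin (p + q))) :
    act (frameProd B l) = (l.map fun j => actVec p q (B *ᵥ Pi.single j 1)).prod := by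
  induction l with
  | nil => simp [frameProd, act_one_eq]
  | cons i l ih =>
    rw [List.map_cons, List.prod_cons, ← ih]
    simp only [frameProd, List.map_cons, List.prod_cons, act_mul_eq]
    rfl

/-- For a lift with spinor norm one the Gram operator is a product of Clifford multiplications by
the first `p` columns of `A x`. This expression involves no choice of lift, so continuity in `x` is
inherited from `A`. -/
theorem nonempty_spinorMetric
    (A : Base p q → Matrix (Fin (p + q)) (Fin (p + q)) ℝ)
    (hA : Continuous A) (hSO : ∀ x, A x ∈ SO₀ p q) :
    Nonempty (SpinorMetric (inducedSubbundle A)) := by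
  refine ⟨⟨fun x => act (timeElt p q) * act (frameProd (A x) (timeList p q).reverse), ?_, ?_⟩⟩
  · simp only [act_frameProd]
    refine continuous_const.mul (continuous_list_prod _ fun j _ => ?_)
    exact continuous_actVec.comp (hA.matrix_mulVec continuous_const)
  · intro x
    obtain ⟨g, hg, hrev, hcov⟩ := spinLift_of_mem_SO₀ (hSO x)
    refine ⟨g, ⟨hg, A x, hSO x, hcov, rfl⟩, fun φ ψ => ?_⟩
    have h := star_act_inv_mul (c := 1) (Spin₀_subset hg) hcov (one_mul 1)
      (by rw [hrev, map_one])
    rw [Complex.ofReal_one, one_smul] at h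
    change inner ℂ φ ((act (timeElt p q) * act (frameProd (A x) (timeList p q).reverse)) ψ) = _
    rw [← h]
    exact ContinuousLinearMap.adjoint_inner_right (act ((g⁻¹ : (Cl p q)ˣ) : Cl p q)) φ _

/-! ### Uniform bounds for adapted spin frames -/

theorem norm_act_frameProd_le {B : Matrix (Fin (p + q)) (Fin (p + q)) ℝ} {K : ℝ}
    {l : List (Fin (p + q))} (hK : 0 ≤ K)
    (h : ∀ j ∈ l, ‖actVec p q (B *ᵥ Pi.single j 1)‖ ≤ K) :
    ‖act (frameProd B l)‖ ≤ K ^ l.length := by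
  rw [act_frameProd]
  induction l with
  | nil => simp
  | cons i l ih =>
    rw [List.map_cons, List.prod_cons, List.length_cons, pow_succ']
    refine (norm_mul_le _ _).trans ?_
    exact mul_le_mul (h i (by simp)) (ih fun j hj => h j (by simp [hj])) (norm_nonneg _) hK

theorem exists_norm_actVec_le (C : ℝ) :
    ∃ K : ℝ, 0 ≤ K ∧ ∀ v : Fin (p + q) → ℝ, (∀ k, |v k| ≤ C) → ‖actVec p q v‖ ≤ K := by
  let L : (Fin (p + q) → ℝ) →L[ℝ] (Δ p q →L[ℂ] Δ p q) := ⟨actVec p q, continuous_actVec⟩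
  refine ⟨‖L‖ * |C|, by positivity, fun v hv => ?_⟩
  refine (L.le_opNorm v).trans (mul_le_mul_of_nonneg_left ?_ (norm_nonneg _))
  exact (pi_norm_le_iff_of_nonneg (abs_nonneg C)).mpr fun k => (hv k).trans (le_abs_self C)

theorem abs_apply_le_norm (B : Matrix (Fin (p + q)) (Fin (p + q)) ℝ) (i j : Fin (p + q)) :
    |B i j| ≤ ‖Matrix.toEuclideanCLM (𝕜 := ℝ) B‖ := by
  have h1 := (Matrix.toEuclideanCLM (𝕜 := ℝ) B).le_opNorm (EuclideanSpace.single j 1)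
  have h2 := PiLp.norm_apply_le
    (Matrix.toEuclideanCLM (𝕜 := ℝ) B (EuclideanSpace.single j 1)) i
  simp only [PiLp.norm_single, norm_one, mul_one] at h1
  have h3 : Matrix.toEuclideanCLM (𝕜 := ℝ) B (EuclideanSpace.single j 1) i = B i j := by
    simp
  rw [h3, Real.norm_eq_abs] at h2
  exact h2.trans h1

theorem mem_timeSpan {B : Matrix (Fin (p + q)) (Fin (p + q)) ℝ} {v : Fin (p + q) → ℝ}
    (hv : v ∈ timeSpan B) : ∃ c : Fin (p + q) → ℝ, (∀ i, ¬ i.val < p → c i = 0) ∧ v = B *ᵥ c := by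
  induction hv using Submodule.span_induction with
  | mem v hv =>
    obtain ⟨j, hj, rfl⟩ := hv
    exact ⟨Pi.single j 1, fun i hi => Pi.single_eq_of_ne (by rintro rfl; exact hi hj) _, rfl⟩
  | zero => exact ⟨0, by simp, by simp⟩
  | add v w _ _ hv hw =>
    obtain ⟨c, hc, rfl⟩ := hv
    obtain ⟨d, hd, rfl⟩ := hw
    exact ⟨c + d, fun i hi => by simp [hc i hi, hd i hi], (Matrix.mulVec_add _ _ _).symm⟩
  | smul a v _ hv =>
    obtain ⟨c, hc, rfl⟩ := hv
    exact ⟨a • c, fun i hi => by simp [hc i hi], (Matrix.mulVec_smul _ _ _).symm⟩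

/-- Unit time-like vectors in the span of a bounded time-like frame are bounded. -/
theorem abs_apply_le_of_timeSpan_eq {A B : Matrix (Fin (p + q)) (Fin (p + q)) ℝ}
    (hA : IsIso A) (hB : IsIso B) (h : timeSpan B = timeSpan A) {C : ℝ}
    (hC : ∀ i j, |A i j| ≤ C) {j : Fin (p + q)} (hj : j.val < p) (k : Fin (p + q)) :
    |(B *ᵥ Pi.single j 1) k| ≤ (p + q : ℕ) * C := by
  have hmem : B *ᵥ Pi.single j 1 ∈ timeSpan A := h ▸ Submodule.subset_span ⟨j, hj, rfl⟩
  obtain ⟨c, hc, hBc⟩ := mem_timeSpan hmem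
  have h1 : negForm p q c = 1 := by
    rw [← hA c, ← hBc, hB, negForm_single, metricSign, if_pos hj, neg_neg]
  rw [negForm_apply] at h1
  -- Since `A` is an isometry, the coordinates `c` have form value one. They are supported on
  -- time-like indices, where the form is the Euclidean square norm.
  have h2 : ∑ i, c i * c i = 1 := by
    rw [← h1]
    refine Finset.sum_congr rfl fun i _ => ?_
    by_cases hi : i.val < p
    · simp [metricSign, hi]
    · simp [hc i hi]
  have h3 : ∀ i, |c i| ≤ 1 := fun i => by
    rw [← abs_one, ← sq_le_sq, one_pow, ← h2, sq]
    exact Finset.single_le_sum (f := fun i => c i * c i) (fun i _ => mul_self_nonneg _)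
      (Finset.mem_univ i)
  rw [hBc, Matrix.mulVec, dotProduct]
  refine (Finset.abs_sum_le_sum_abs _ _).trans ?_
  calc ∑ i, |A k i * c i| ≤ ∑ _i : Fin (p + q), C := by
        refine Finset.sum_le_sum fun i _ => ?_
        rw [abs_mul]
        exact (mul_le_of_le_one_right (abs_nonneg _) (h3 i)).trans (hC k i)
    _ = (p + q : ℕ) * C := by simp

theorem exists_frame_bound {A : Base p q → Matrix (Fin (p + q)) (Fin (p + q)) ℝ}
    (hSO : ∀ x, A x ∈ SO₀ p q)
    (hbdd : ∃ C : ℝ, ∀ x, ‖Matrix.toEuclideanCLM (𝕜 := ℝ) (A x)‖ ≤ C) :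
    ∃ K : ℝ, 0 < K ∧ ∀ x, ∀ g ∈ adaptedSpinFrames (inducedSubbundle A x),
      ‖act (g : Cl p q)‖ ≤ K ∧ ‖act ((g⁻¹ : (Cl p q)ˣ) : Cl p q)‖ ≤ K := by
  obtain ⟨C, hC⟩ := hbdd
  obtain ⟨K, hK0, hK⟩ := exists_norm_actVec_le (p := p) (q := q) ((p + q : ℕ) * C)
  set n := (timeList p q).length with hn
  -- The two products bound `‖g g†‖` and `‖(g⁻¹)† g⁻¹‖`. The summand `1` gives `M ≤ M²`, so that a
  -- bound `‖T‖² ≤ M` yields `‖T‖ ≤ M` without square roots.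
  set M := K ^ n * ‖act (timeElt p q)‖ +
    K ^ n * ‖act (frameProd (p := p) (q := q) 1 (timeList p q).reverse)‖ + 1
    with hM
  have hM1 : 1 ≤ M := by
    rw [hM]; exact le_add_of_nonneg_left (by positivity)
  have hMsq : M ≤ M * M := le_mul_of_one_le_left (by positivity) hM1
  refine ⟨M, by positivity, fun x g hg => ?_⟩
  obtain ⟨hg0, B, hB, hcov, hspan⟩ := hg
  have hsub : SO₀ p q ⊆ SO p q := connectedComponentIn_subset _ _
  have hBK : ∀ j ∈ timeList p q, ‖actVec p q (B *ᵥ Pi.single j 1)‖ ≤ K := fun j hj =>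
    hK _ fun k => abs_apply_le_of_timeSpan_eq (isIso_of_mem_SO (hsub (hSO x)))
      (isIso_of_mem_SO (hsub hB)) hspan (fun i l => (abs_apply_le_norm _ i l).trans (hC x))
      (mem_timeList.mp hj) k
  obtain ⟨c, hc, hrev⟩ := spinorNorm_of_mem_Spin (Spin₀_subset hg0)
  have hcn : ‖c‖ = 1 := by
    have : ‖c‖ * ‖c‖ = 1 := by rw [← norm_mul, hc, norm_one]
    nlinarith [norm_nonneg c]
  have hle : ∀ T : Δ p q →L[ℂ] Δ p q, ‖T‖ * ‖T‖ ≤ M → ‖T‖ ≤ M := fun T hT =>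
    abs_le_of_sq_le_sq' (by nlinarith) (by positivity) |>.2
  constructor
  · refine hle _ ?_
    rw [← CStarRing.norm_self_mul_star, act_mul_star (Spin₀_subset hg0) hcov hc hrev, norm_smul,
      Complex.norm_real, hcn, one_mul]
    refine (norm_mul_le _ _).trans ?_
    have h1 := norm_act_frameProd_le hK0 hBK
    refine (mul_le_mul_of_nonneg_right h1 (norm_nonneg _)).trans ?_
    rw [hM, ← hn]
    have : 0 ≤ K ^ n * ‖act (timeElt p q)‖ := by positivity
    linarith
  · refine hle _ ?_
    rw [← CStarRing.norm_star_mul_self, star_act_inv_mul (Spin₀_subset hg0) hcov hc hrev,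
      norm_smul, Complex.norm_real, hcn, one_mul]
    refine (norm_mul_le _ _).trans ?_
    have h1 := norm_act_frameProd_le (l := (timeList p q).reverse) hK0
      (fun j hj => hBK j (List.mem_reverse.mp hj))
    rw [List.length_reverse, ← hn] at h1
    refine (mul_le_mul_of_nonneg_left h1 (norm_nonneg _)).trans ?_
    rw [hM]
    have : 0 ≤ K ^ n * ‖act (frameProd (p := p) (q := q) 1 (timeList p q).reverse)‖ := by positivity
    linarith [mul_comm ‖act (timeElt p q)‖ (K ^ n)]

/-! ### First order operators with constant coefficients -/

section FirstOrder

open MeasureTheory Filter Topology SchwartzMap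
open scoped FourierTransform LineDeriv

variable {ι : Type*} [Fintype ι] {F : Type*} [NormedAddCommGroup F] [InnerProductSpace ℂ F]

/-- A smooth cutoff function equal to one near the origin. -/
theorem exists_cutoff : ∃ χ : EuclideanSpace ℝ ι → ℝ, ContDiff ℝ ∞ χ ∧ HasCompactSupport χ ∧
    (∀ x, ‖x‖ < 1 → χ x = 1) ∧ (∀ x, |χ x| ≤ 1) := by
  let χ : ContDiffBump (0 : EuclideanSpace ℝ ι) := ⟨1, 2, one_pos, one_lt_two⟩
  refine ⟨χ, χ.contDiff, χ.hasCompactSupport, fun x hx => χ.one_of_mem_closedBall ?_, fun x => ?_⟩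
  · simpa using hx.le
  · rw [abs_of_nonneg χ.nonneg]; exact χ.le_one

theorem fderiv_comp_smul (χ : EuclideanSpace ℝ ι → ℝ) (hχ : Differentiable ℝ χ) (r : ℝ)
    (x : EuclideanSpace ℝ ι) :
    fderiv ℝ (fun y => χ (r • y)) x = r • fderiv ℝ χ (r • x) := by
  have h1 : HasFDerivAt (fun y : EuclideanSpace ℝ ι => r • y)
      (r • ContinuousLinearMap.id ℝ (EuclideanSpace ℝ ι)) x := (hasFDerivAt_id x).const_smul r
  have h2 := ((hχ (r • x)).hasFDerivAt.comp x h1).fderiv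
  change fderiv ℝ (χ ∘ fun y => r • y) x = _
  rw [h2]
  ext v; simp

theorem fourier_postcompCLM [CompleteSpace F] (L : F →L[ℂ] F) (f : 𝓢(EuclideanSpace ℝ ι, F)) :
    𝓕 (f.postcompCLM L) = (𝓕 f).postcompCLM L := by
  ext ξ
  rw [postcompCLM_apply, fourier_coe, fourier_coe, Real.fourier_eq, Real.fourier_eq,
    ← ContinuousLinearMap.integral_comp_comm]
  · refine integral_congr_ae (Eventually.of_forall fun v => ?_)
    simp [Circle.smul_def]
  · exact (Real.fourierIntegral_convergent_iff _).mpr f.integrable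

variable [DecidableEq ι]

/-- The operator `∑ M_j ∂_j`. -/
noncomputable def firstOrder (M : ι → F →L[ℂ] F) (ψ : EuclideanSpace ℝ ι → F)
    (x : EuclideanSpace ℝ ι) : F :=
  ∑ j, M j (fderiv ℝ ψ x (EuclideanSpace.single j 1))

theorem firstOrder_smul (M : ι → F →L[ℂ] F) {χ : EuclideanSpace ℝ ι → ℝ}
    {ψ : EuclideanSpace ℝ ι → F} {x : EuclideanSpace ℝ ι} (hχ : DifferentiableAt ℝ χ x)
    (hψ : DifferentiableAt ℝ ψ x) :
    firstOrder M (fun y => χ y • ψ y) x = χ x • firstOrder M ψ x +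
      ∑ j, fderiv ℝ χ x (EuclideanSpace.single j 1) • M j (ψ x) := by
  simp only [firstOrder, Finset.smul_sum, ← Finset.sum_add_distrib]
  refine Finset.sum_congr rfl fun j _ => ?_
  rw [fderiv_fun_smul hχ hψ]
  simp

theorem firstOrder_congr (M : ι → F →L[ℂ] F) {ψ φ : EuclideanSpace ℝ ι → F}
    {x : EuclideanSpace ℝ ι} (h : ψ =ᶠ[𝓝 x] φ) : firstOrder M ψ x = firstOrder M φ x := by
  simp only [firstOrder, h.fderiv_eq]

/-- `∑ M_j ∂_j` on Schwartz functions. -/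
noncomputable def schwartzFirstOrder (M : ι → F →L[ℂ] F) (f : 𝓢(EuclideanSpace ℝ ι, F)) :
    𝓢(EuclideanSpace ℝ ι, F) :=
  ∑ j, postcompCLM (M j) (∂_{EuclideanSpace.single j (1 : ℝ)} f : 𝓢(EuclideanSpace ℝ ι, F))

theorem schwartzFirstOrder_apply (M : ι → F →L[ℂ] F) (f : 𝓢(EuclideanSpace ℝ ι, F))
    (x : EuclideanSpace ℝ ι) : schwartzFirstOrder M f x = firstOrder M f x := by
  simp [schwartzFirstOrder, firstOrder, sum_apply, lineDerivOp_apply_eq_fderiv]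

/-- The norm of `∑ a_j M_j` is controlled by the coefficient vector. -/
theorem norm_sum_smul_le (M : ι → F →L[ℂ] F) (L : EuclideanSpace ℝ ι →L[ℝ] ℝ) (v : F) :
    ‖∑ j, L (EuclideanSpace.single j 1) • M j v‖ ≤ (∑ j, ‖M j‖) * ‖L‖ * ‖v‖ := by
  refine (norm_sum_le _ _).trans ?_
  rw [Finset.sum_mul, Finset.sum_mul]
  refine Finset.sum_le_sum fun j _ => ?_
  rw [norm_smul]
  have h1 := L.le_opNorm (EuclideanSpace.single j 1)
  rw [PiLp.norm_single, norm_one, mul_one] at h1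
  calc _ ≤ ‖L‖ * (‖M j‖ * ‖v‖) :=
        mul_le_mul h1 ((M j).le_opNorm v) (norm_nonneg _) (norm_nonneg _)
    _ = _ := by ring

/-- Orthogonality to the range of `z - ∑ M_j ∂_j` on test functions extends to Schwartz
functions. -/
theorem integral_schwartz_eq_zero (M : ι → F →L[ℂ] F) (z : ℂ)
    (u : Lp F 2 (volume : Measure (EuclideanSpace ℝ ι)))
    (h : ∀ ψ : EuclideanSpace ℝ ι → F, ContDiff ℝ ∞ ψ → HasCompactSupport ψ →
      ∫ x, inner ℂ (u x) (z • ψ x - firstOrder M ψ x) = 0) (f : 𝓢(EuclideanSpace ℝ ι, F)) :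
    ∫ x, inner ℂ (u x) (z • f x - firstOrder M f x) = 0 := by
  obtain ⟨χ, hχ, hχc, hχ1, hχle⟩ := exists_cutoff (ι := ι)
  have hχd : Differentiable ℝ χ := hχ.differentiable (by simp)
  obtain ⟨C, hC⟩ := (hχc.fderiv ℝ).exists_bound_of_continuous (hχ.continuous_fderiv (by simp))
  -- The Schwartz function is cut off at radius about `1 / r k`. The commutator with the cutoff is
  -- bounded by a multiple of `‖f‖`, which supplies the dominating function; pointwise, the
  -- integrand is eventually equal to its limit.
  let r : ℕ → ℝ := fun k => ((k : ℝ) + 1)⁻¹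
  have hr0 : ∀ k, 0 < r k := fun k => by positivity
  have hr1 : ∀ k, r k ≤ 1 := fun k => inv_le_one_of_one_le₀ (by simp)
  have hrlim : Tendsto r atTop (𝓝 0) := by
    simpa [r, one_div] using tendsto_one_div_add_atTop_nhds_zero_nat (𝕜 := ℝ)
  let ψ : ℕ → EuclideanSpace ℝ ι → F := fun k x => χ (r k • x) • f x
  have hχk : ∀ k, ContDiff ℝ ∞ fun x : EuclideanSpace ℝ ι => χ (r k • x) := fun k =>
    hχ.comp (contDiff_const_smul (r k))
  have hzero : ∀ k, ∫ x, inner ℂ (u x) (z • ψ k x - firstOrder M (ψ k) x) = 0 := fun k => by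
    refine h _ ((hχk k).smul (f.smooth ⊤)) ?_
    exact (hχc.comp_smul (hr0 k).ne').smul_right
  have hu : MemLp (fun x => ‖u x‖) 2 volume := (Lp.memLp u).norm
  have hf1 : MemLp (fun x => ‖z • f x - firstOrder M f x‖) 2 volume := by
    have := ((z • f - schwartzFirstOrder M f).memLp 2 volume).norm
    simpa [schwartzFirstOrder_apply] using this
  have hf2 : MemLp (fun x => ((∑ j, ‖M j‖) * C) * ‖f x‖) 2 volume := by
    exact (f.memLp 2 volume).norm.const_mul _
  have hint : Integrable (fun x => ‖u x‖ *
      (‖z • f x - firstOrder M f x‖ + ((∑ j, ‖M j‖) * C) * ‖f x‖)) volume :=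
    hu.integrable_mul (hf1.add hf2)
  have hC0 : 0 ≤ C := (norm_nonneg _).trans (hC 0)
  have hleib : ∀ k x, z • ψ k x - firstOrder M (ψ k) x = χ (r k • x) • (z • f x - firstOrder M f x)
      - ∑ j, fderiv ℝ (fun y => χ (r k • y)) x (EuclideanSpace.single j 1) • M j (f x) := by
    intro k x
    rw [firstOrder_smul M ((hχk k).differentiable (by simp) x) f.differentiableAt, smul_sub,
      smul_comm z (χ (r k • x))]
    abel
  have hlim := tendsto_integral_of_dominated_convergence
    (F := fun k x => inner ℂ (u x) (z • ψ k x - firstOrder M (ψ k) x))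
    (f := fun x => inner ℂ (u x) (z • f x - firstOrder M f x)) _ ?_ hint ?_ ?_
  · simp only [hzero] at hlim
    exact (tendsto_nhds_unique tendsto_const_nhds hlim).symm
  · intro k
    refine (Lp.aestronglyMeasurable u).inner ?_
    refine Continuous.aestronglyMeasurable ?_
    have h1 : ContDiff ℝ ∞ (ψ k) := (hχk k).smul (f.smooth ⊤)
    refine (h1.continuous.const_smul z).sub (continuous_finsetSum _ fun j _ => ?_)
    exact (M j).continuous.comp ((h1.continuous_fderiv (by simp)).clm_apply continuous_const)
  · intro k
    refine Eventually.of_forall fun x => (norm_inner_le_norm _ _).trans ?_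
    refine mul_le_mul_of_nonneg_left ?_ (norm_nonneg _)
    rw [hleib]
    refine (norm_sub_le _ _).trans (add_le_add ?_ ?_)
    · rw [norm_smul]
      exact mul_le_of_le_one_left (norm_nonneg _) (hχle _)
    · refine (norm_sum_smul_le M _ _).trans ?_
      refine mul_le_mul_of_nonneg_right (mul_le_mul_of_nonneg_left ?_
        (Finset.sum_nonneg fun j _ => norm_nonneg _)) (norm_nonneg _)
      rw [fderiv_comp_smul χ hχd, norm_smul, Real.norm_of_nonneg (hr0 k).le]
      exact (mul_le_of_le_one_left (norm_nonneg _) (hr1 k)).trans (hC _)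
  · refine Eventually.of_forall fun x => tendsto_const_nhds.congr' ?_
    have hx : ∀ᶠ k in atTop, ‖r k • x‖ < 1 := by
      have : Tendsto (fun k => ‖r k • x‖) atTop (𝓝 0) := by
        have := (hrlim.smul_const x).norm
        simpa using this
      exact this.eventually_lt_const one_pos
    filter_upwards [hx] with k hk
    have heq : ψ k =ᶠ[𝓝 x] f := by
      have hcont : ContinuousAt (fun y : EuclideanSpace ℝ ι => ‖r k • y‖) x := by fun_prop
      filter_upwards [hcont.eventually_lt continuousAt_const hk] with y hy
      simp only [ψ, hχ1 _ hy, one_smul]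
    rw [firstOrder_congr M heq, heq.eq_of_nhds]

/-! ### The Fourier transform and uniqueness of weak solutions -/

/-- The symbol `∑ 2πi ξ_j M_j` of `∑ M_j ∂_j`. -/
noncomputable def symbolOp (M : ι → F →L[ℂ] F) (ξ : EuclideanSpace ℝ ι) : F →L[ℂ] F :=
  ∑ j, (2 * Real.pi * Complex.I * ξ j : ℂ) • M j

theorem fourier_schwartzFirstOrder [CompleteSpace F] (M : ι → F →L[ℂ] F)
    (f : 𝓢(EuclideanSpace ℝ ι, F))
    (ξ : EuclideanSpace ℝ ι) :
    𝓕 (schwartzFirstOrder M f) ξ = symbolOp M ξ (𝓕 f ξ) := by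
  have hsum : 𝓕 (schwartzFirstOrder M f) =
      ∑ j, 𝓕 (postcompCLM (M j)
        (∂_{EuclideanSpace.single j (1 : ℝ)} f : 𝓢(EuclideanSpace ℝ ι, F))) := by
    simp only [← fourierTransformCLM_apply ℂ]
    exact map_sum (fourierTransformCLM ℂ) _ _
  rw [hsum, sum_apply, symbolOp, sum_apply]
  refine Finset.sum_congr rfl fun j _ => ?_
  have htg : Function.HasTemperateGrowth
      (fun x : EuclideanSpace ℝ ι => inner ℝ x (EuclideanSpace.single j (1 : ℝ))) := by fun_prop
  rw [fourier_postcompCLM, postcompCLM_apply, fourier_lineDerivOp_eq, smul_apply,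
    smulLeftCLM_apply_apply htg]
  simp [EuclideanSpace.inner_single_right, mul_smul]

end FirstOrder

section WeakSolutions

open MeasureTheory Filter Topology SchwartzMap
open scoped FourierTransform LineDeriv

/-- A real quadric with nonzero leading coefficient in one variable is a null set. -/
theorem ae_quadric_ne {ι : Type*} [Fintype ι] (s : ι → ℝ) {k : ι} (hs : s k ≠ 0) (w : ℂ) :
    ∀ᵐ ξ : EuclideanSpace ℝ ι, w - ((∑ j, s j * ξ j ^ 2 : ℝ) : ℂ) ≠ 0 := by
  classical
  have hcont : Continuous fun ξ : EuclideanSpace ℝ ι => w - ((∑ j, s j * ξ j ^ 2 : ℝ) : ℂ) := by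
    refine continuous_const.sub (Complex.continuous_ofReal.comp ?_)
    fun_prop
  have hmeas : MeasurableSet {ξ : EuclideanSpace ℝ ι | w - ((∑ j, s j * ξ j ^ 2 : ℝ) : ℂ) ≠ 0} :=
    (isOpen_ne_fun hcont continuous_const).measurableSet
  -- By Fubini it suffices that every line in the direction `e_k` meets the quadric in a null set.
  -- On such a line the real part of the equation reads `(y k + t)² = c`, which has at most two
  -- solutions.
  refine (ae_ae_add_linearMap_mem_iff
    (LinearMap.toSpanSingleton ℝ (EuclideanSpace ℝ ι) (EuclideanSpace.single k 1))
    (volume : Measure ℝ) volume hmeas).mp (Eventually.of_forall fun y => ?_)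
  set c : ℝ := (w.re - ∑ j ∈ Finset.univ.erase k, s j * y j ^ 2) / s k
  refine measure_mono_null ?_
    (((Set.finite_singleton (Real.sqrt c - y k)).insert (-Real.sqrt c - y k)).measure_zero volume)
  intro t ht
  have h0 : w - ((∑ j, s j * (y + t • EuclideanSpace.single k (1 : ℝ)) j ^ 2 : ℝ) : ℂ) = 0 := by
    simpa using ht
  have h1 := congrArg Complex.re h0
  rw [Complex.sub_re, Complex.ofReal_re, Complex.zero_re,
    ← Finset.add_sum_erase _ _ (Finset.mem_univ k)] at h1
  have h2 : ∑ j ∈ Finset.univ.erase k, s j * (y + t • EuclideanSpace.single k (1 : ℝ)) j ^ 2 =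
      ∑ j ∈ Finset.univ.erase k, s j * y j ^ 2 := by
    refine Finset.sum_congr rfl fun j hj => ?_
    simp [Finset.ne_of_mem_erase hj]
  rw [h2] at h1
  have h3 : (y k + t) ^ 2 = c := by
    rw [eq_div_iff hs]
    have : (y + t • EuclideanSpace.single k (1 : ℝ)) k = y k + t := by simp
    rw [this] at h1
    linarith
  have h4 : |y k + t| = Real.sqrt c := by rw [← h3, Real.sqrt_sq_eq_abs]
  rcases abs_choice (y k + t) with h | h <;> rw [h] at h4
  · right; rw [Set.mem_singleton_iff]; linarith
  · left; linarith

variable {ι : Type*} [Fintype ι] {F : Type*} [NormedAddCommGroup F] [InnerProductSpace ℂ F]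

/-- Adding the double sum to its transpose replaces products by anticommutators, of which only the
diagonal ones survive. -/
theorem clifford_sq {M : ι → F →L[ℂ] F} {s : ι → ℝ}
    (hanti : ∀ i j, i ≠ j → M i * M j + M j * M i = 0)
    (hsq : ∀ j, M j * M j = -((s j : ℂ) • 1)) (a : ι → ℂ) :
    (∑ j, a j • M j) * (∑ j, a j • M j) = -((∑ j, (s j : ℂ) * a j ^ 2) • 1) := by
  have key : (∑ j, a j • M j) * (∑ j, a j • M j) = ∑ i, ∑ j, (a i * a j) • (M i * M j) := by
    simp only [Finset.sum_mul_sum, smul_mul_smul_comm]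
  have key2 : (∑ j, a j • M j) * (∑ j, a j • M j) = ∑ i, ∑ j, (a i * a j) • (M j * M i) := by
    rw [key, Finset.sum_comm]
    simp only [mul_comm (a _) (a _)]
  have h2 : (2 : ℂ) • ((∑ j, a j • M j) * (∑ j, a j • M j)) =
      (2 : ℂ) • -((∑ j, (s j : ℂ) * a j ^ 2) • (1 : F →L[ℂ] F)) := by
    rw [two_smul]
    nth_rewrite 1 [key]
    rw [key2, ← Finset.sum_add_distrib]
    simp only [← Finset.sum_add_distrib, ← smul_add]
    rw [Finset.sum_smul, ← Finset.sum_neg_distrib, Finset.smul_sum]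
    refine Finset.sum_congr rfl fun i _ => ?_
    rw [Finset.sum_eq_single i]
    · rw [hsq]
      module
    · intro j _ hj
      rw [hanti i j (Ne.symm hj), smul_zero]
    · simp
  exact smul_right_injective _ (two_ne_zero) h2

theorem symbolOp_symbolOp {M : ι → F →L[ℂ] F} {s : ι → ℝ}
    (hanti : ∀ i j, i ≠ j → M i * M j + M j * M i = 0)
    (hsq : ∀ j, M j * M j = -((s j : ℂ) • 1)) (ξ : EuclideanSpace ℝ ι) (v : F) :
    symbolOp M ξ (symbolOp M ξ v) = ((∑ j, 4 * Real.pi ^ 2 * s j * ξ j ^ 2 : ℝ) : ℂ) • v := by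
  change (symbolOp M ξ * symbolOp M ξ) v = _
  rw [symbolOp, clifford_sq hanti hsq]
  simp only [smul_apply, one_apply_eq_self, ← neg_smul, ← Finset.sum_neg_distrib]
  congr 1
  push_cast
  refine Finset.sum_congr rfl fun j _ => ?_
  linear_combination (-4 * (s j : ℂ) * Real.pi ^ 2 * (ξ j : ℂ) ^ 2) * Complex.I_sq

/-- A square integrable field that is orthogonal to the range of `z - ∑ M_j ∂_j` on test functions
vanishes, if the `M_j` satisfy Clifford relations. -/
theorem eq_zero_of_weak_solution [DecidableEq ι] [FiniteDimensional ℂ F]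
    {M : ι → F →L[ℂ] F} {s : ι → ℝ}
    (hanti : ∀ i j, i ≠ j → M i * M j + M j * M i = 0)
    (hsq : ∀ j, M j * M j = -((s j : ℂ) • 1)) {k : ι} (hs : s k ≠ 0) (z : ℂ)
    (u : Lp F 2 (volume : Measure (EuclideanSpace ℝ ι)))
    (h : ∀ ψ : EuclideanSpace ℝ ι → F, ContDiff ℝ ∞ ψ → HasCompactSupport ψ →
      ∫ x, inner ℂ (u x) (z • ψ x - firstOrder M ψ x) = 0) : u = 0 := by
  have : CompleteSpace F := FiniteDimensional.complete ℂ F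
  have hS : ∀ f : 𝓢(EuclideanSpace ℝ ι, F),
      inner ℂ u ((z • f - schwartzFirstOrder M f).toLp 2 volume) = 0 := by
    intro f
    rw [L2.inner_def, ← integral_schwartz_eq_zero M z u h f]
    refine integral_congr_ae ?_
    filter_upwards [coeFn_toLp (z • f - schwartzFirstOrder M f) 2 volume] with x hx
    rw [hx]
    rw [sub_apply, smul_apply, schwartzFirstOrder_apply]
  let m : EuclideanSpace ℝ ι → ℂ := fun ξ =>
    z ^ 2 - ((∑ j, 4 * Real.pi ^ 2 * s j * ξ j ^ 2 : ℝ) : ℂ)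
  have hmc : Continuous m := by
    refine continuous_const.sub (Complex.continuous_ofReal.comp ?_)
    fun_prop
  let v : Lp F 2 (volume : Measure (EuclideanSpace ℝ ι)) := 𝓕 u
  have hF : ∀ w : 𝓢(EuclideanSpace ℝ ι, F), ∫ ξ, inner ℂ (v ξ) (m ξ • w ξ) = 0 := by
    intro w
    -- This choice makes the symbols combine to `(z - σ)(z + σ) = z² - σ²`, which is the scalar `m`.
    let f : 𝓢(EuclideanSpace ℝ ι, F) := z • 𝓕⁻ w + schwartzFirstOrder M (𝓕⁻ w)
    have h1 := hS f
    rw [← Lp.inner_fourier_eq, SchwartzMap.toLp_fourier_eq, L2.inner_def] at h1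
    rw [← h1]
    refine integral_congr_ae ?_
    filter_upwards [coeFn_toLp (𝓕 (z • f - schwartzFirstOrder M f)) 2 volume] with ξ hξ
    rw [hξ]
    congr 1
    have e1 : 𝓕 (z • f - schwartzFirstOrder M f) = z • 𝓕 f - 𝓕 (schwartzFirstOrder M f) := by
      simp only [← fourierTransformCLM_apply ℂ, map_sub, map_smul]
    have e2 : 𝓕 f ξ = z • w ξ + symbolOp M ξ (w ξ) := by
      have : 𝓕 f = z • 𝓕 (𝓕⁻ w) + 𝓕 (schwartzFirstOrder M (𝓕⁻ w)) := by
        simp only [f, ← fourierTransformCLM_apply ℂ, map_add, map_smul]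
      rw [this, add_apply, smul_apply, fourier_schwartzFirstOrder,
        FourierTransform.fourier_fourierInv_eq]
    rw [e1, sub_apply, smul_apply, fourier_schwartzFirstOrder, e2, map_add, map_smul,
      symbolOp_symbolOp hanti hsq]
    simp only [m, sub_smul, smul_add, smul_smul, sq]
    abel
  -- The scalar is moved onto `v`, hence conjugated. The product with the unbounded `m` is only
  -- locally integrable, which is enough for testing against compactly supported functions.
  let G : EuclideanSpace ℝ ι → F := fun ξ => (starRingEnd ℂ) (m ξ) • v ξ
  have hGloc : LocallyIntegrable G volume := by
    have hv : LocallyIntegrable v volume := (Lp.memLp v).locallyIntegrable (by norm_num)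
    rw [← locallyIntegrableOn_univ] at hv ⊢
    exact hv.continuousOn_smul isOpen_univ.isLocallyClosed
      (Complex.continuous_conj.comp hmc).continuousOn
  have hG : ∀ᵐ ξ, G ξ = 0 := by
    refine ae_eq_zero_of_integral_contDiff_smul_eq_zero hGloc fun g hg hgc => ?_
    refine ext_inner_right ℂ fun φ => ?_
    have hint : Integrable (fun ξ => g ξ • G ξ) volume :=
      hGloc.integrable_smul_left_of_hasCompactSupport hg.continuous hgc
    rw [inner_zero_left, ← inner_conj_symm, ← integral_inner hint, ← integral_conj]
    have hw : HasCompactSupport fun ξ => g ξ • φ := hgc.smul_right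
    have hw' : ContDiff ℝ ∞ fun ξ => g ξ • φ := hg.smul contDiff_const
    rw [← hF (hw.toSchwartzMap hw')]
    refine integral_congr_ae (Eventually.of_forall fun ξ => ?_)
    simp only [G, HasCompactSupport.toSchwartzMap_toFun, inner_conj_symm]
    rw [← Complex.coe_smul, ← Complex.coe_smul, inner_smul_left, inner_smul_left, inner_smul_right,
      inner_smul_right]
    simp only [Complex.conj_ofReal, Complex.conj_conj]
    ring
  have hv0 : v = 0 := by
    refine (Lp.eq_zero_iff_ae_eq_zero).mpr ?_
    have hs' : 4 * Real.pi ^ 2 * s k ≠ 0 := by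
      have := Real.pi_ne_zero
      positivity
    filter_upwards [hG, ae_quadric_ne (fun j => 4 * Real.pi ^ 2 * s j) hs' (z ^ 2)] with ξ h1 h2
    exact (smul_eq_zero.mp h1).resolve_left fun h3 => h2 ((map_eq_zero _).mp h3)
  have hn := Lp.norm_fourier_eq u
  rw [show 𝓕 u = 0 from hv0, norm_zero] at hn
  exact norm_eq_zero.mp hn.symm

end WeakSolutions

/-! ### Integration by parts and approximate eigenfunctions -/

section ApproximateEigenfunctions

open MeasureTheory Filter Topology SchwartzMap
open scoped FourierTransform LineDeriv

variable {ι : Type*} [Fintype ι] {F : Type*} [NormedAddCommGroup F] [InnerProductSpace ℂ F]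

/-- The plane wave `e^{i ⟨a, x⟩} φ`. -/
noncomputable def planeWave (a : ι → ℝ) (φ : F) (x : EuclideanSpace ℝ ι) : F :=
  Complex.exp (((∑ j, a j * x j : ℝ) : ℂ) * Complex.I) • φ

theorem contDiff_planeWave (a : ι → ℝ) (φ : F) : ContDiff ℝ ∞ (planeWave a φ) := by
  unfold planeWave
  have : ContDiff ℝ ∞ fun x : EuclideanSpace ℝ ι => ∑ j, a j * x j := by fun_prop
  have h2 := Complex.ofRealCLM.contDiff.comp this
  exact ((h2.mul contDiff_const).cexp).smul contDiff_const

theorem norm_planeWave (a : ι → ℝ) (φ : F) (x : EuclideanSpace ℝ ι) :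
    ‖planeWave a φ x‖ = ‖φ‖ := by
  rw [planeWave, norm_smul, Complex.norm_exp_ofReal_mul_I, one_mul]

variable [DecidableEq ι]

/-- Integration by parts: the formal adjoint of `∑ M_j ∂_j` is `-∑ M_j† ∂_j`. -/
theorem integral_inner_firstOrder [CompleteSpace F] (M : ι → F →L[ℂ] F)
    (f g : 𝓢(EuclideanSpace ℝ ι, F)) :
    ∫ x, inner ℂ (f x) (firstOrder M g x) =
      -∫ x, inner ℂ (firstOrder (fun j => star (M j)) f x) (g x) := by
  -- Building `M_j†` into a real bilinear pairing reduces the claim to scalar integration by parts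
  -- in each coordinate.
  let B : ι → F →L[ℝ] F →L[ℝ] ℂ := fun j =>
    ((isBoundedBilinearMap_inner (𝕜 := ℂ) (E := F)).toContinuousLinearMap).comp
      ((star (M j)).restrictScalars ℝ)
  have hB : ∀ j v w, B j v w = inner ℂ (star (M j) v) w := fun j v w => rfl
  have h1 : ∀ x, inner ℂ (f x) (firstOrder M g x) =
      ∑ j, B j (f x) (∂_{EuclideanSpace.single j (1 : ℝ)} g x) := by
    intro x
    rw [firstOrder, inner_sum]
    refine Finset.sum_congr rfl fun j _ => ?_
    rw [hB, lineDerivOp_apply_eq_fderiv]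
    exact (ContinuousLinearMap.adjoint_inner_left _ _ _).symm
  have h2 : ∀ x, inner ℂ (firstOrder (fun j => star (M j)) f x) (g x) =
      ∑ j, B j (∂_{EuclideanSpace.single j (1 : ℝ)} f x) (g x) := by
    intro x
    rw [firstOrder, sum_inner]
    refine Finset.sum_congr rfl fun j _ => ?_
    rw [hB, lineDerivOp_apply_eq_fderiv]
  have h3 : ∀ j ∈ Finset.univ,
      Integrable (fun x => B j (∂_{EuclideanSpace.single j (1 : ℝ)} f x) (g x)) := fun j _ =>
    (bilinLeftCLM (B j) g.hasTemperateGrowth (∂_{EuclideanSpace.single j (1 : ℝ)} f)).integrable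
  simp only [h1, h2]
  rw [integral_finsetSum _ fun j _ => (bilinLeftCLM (B j)
      (∂_{EuclideanSpace.single j (1 : ℝ)} g).hasTemperateGrowth f).integrable,
    integral_finsetSum _ h3, ← Finset.sum_neg_distrib]
  exact Finset.sum_congr rfl fun j _ => integral_bilinear_lineDerivOp_right_eq_neg_left f g (B j) _

theorem firstOrder_planeWave (M : ι → F →L[ℂ] F) (a : ι → ℝ) (φ : F)
    (x : EuclideanSpace ℝ ι) :
    firstOrder M (planeWave a φ) x =
      planeWave a (Complex.I • (∑ j, (a j : ℂ) • M j) φ) x := by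
  let L : EuclideanSpace ℝ ι →L[ℝ] ℂ :=
    Complex.I • (Complex.ofRealCLM.comp (innerSL ℝ (WithLp.toLp 2 a)))
  have hL : ∀ y, L y = ((∑ j, a j * y j : ℝ) : ℂ) * Complex.I := by
    intro y
    simp [L, PiLp.inner_apply, mul_comm]
  have hLs : ∀ j, L (EuclideanSpace.single j 1) = a j * Complex.I := by
    intro j
    simp [L, mul_comm, EuclideanSpace.inner_single_right]
  have hd : HasFDerivAt (planeWave a φ) ((Complex.exp (L x) • L).smulRight φ) x := by
    have := (L.hasFDerivAt (x := x)).cexp.smul_const φ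
    refine this.congr_of_eventuallyEq (Eventually.of_forall fun y => ?_)
    simp only [planeWave, hL]
  simp only [firstOrder, hd.fderiv, ContinuousLinearMap.smulRight_apply, smul_apply, hLs,
    planeWave, sum_apply, Finset.smul_sum, map_smul, ← hL, smul_smul, smul_eq_mul]
  refine Finset.sum_congr rfl fun j _ => ?_
  congr 1; ring

/-- If the symbol of `∑ M_j ∂_j` is nilpotent and nonzero in some direction, every complex number
is an approximate eigenvalue. -/
theorem exists_approximate_eigenfunction (M : ι → F →L[ℂ] F) (a : ι → ℝ)
    (hT : (∑ j, (a j : ℂ) • M j) * (∑ j, (a j : ℂ) • M j) = 0) {η : F}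
    (hη : (∑ j, (a j : ℂ) • M j) η ≠ 0) (z : ℂ) {ε : ℝ} (hε : 0 < ε) :
    ∃ ψ : EuclideanSpace ℝ ι → F, ContDiff ℝ ∞ ψ ∧ HasCompactSupport ψ ∧ 0 < ∫ x, ‖ψ x‖ ^ 2 ∧
      ∫ x, ‖z • ψ x - firstOrder M ψ x‖ ^ 2 ≤ ε * ∫ x, ‖ψ x‖ ^ 2 := by
  obtain ⟨χ, hχ, hχc, hχ1, -⟩ := exists_cutoff (ι := ι)
  have hχd : Differentiable ℝ χ := hχ.differentiable (by simp)
  set T := ∑ j, (a j : ℂ) • M j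
  set K := ∑ j, ‖M j‖
  have hc1 : Continuous fun x => χ x ^ 2 := hχ.continuous.pow 2
  have hs1 : HasCompactSupport fun x => χ x ^ 2 := by
    refine hχc.comp_left (g := fun y => y ^ 2) (by norm_num)
  have hc2 : Continuous fun x => ‖fderiv ℝ χ x‖ ^ 2 :=
    (hχ.continuous_fderiv (by simp)).norm.pow 2
  have hs2 : HasCompactSupport fun x => ‖fderiv ℝ χ x‖ ^ 2 :=
    (hχc.fderiv ℝ).comp_left (g := fun y => ‖y‖ ^ 2) (by norm_num)
  set A := ∫ x, χ x ^ 2 with hA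
  set B := ∫ x, ‖fderiv ℝ χ x‖ ^ 2 with hB
  have hA0 : 0 < A := by
    refine hc1.integral_pos_of_hasCompactSupport_nonneg_nonzero hs1 (fun x => sq_nonneg _)
      (x := 0) ?_
    rw [hχ1 0 (by simp)]; norm_num
  have hB0 : 0 ≤ B := integral_nonneg fun x => sq_nonneg _
  obtain ⟨t, φ, hφ, hφ0, hφε⟩ : ∃ t : ℝ, ∃ φ : F,
      z • φ - (t * Complex.I) • T φ = z ^ 2 • η ∧ 0 < ‖φ‖ ∧
        4 * ‖z ^ 2 • η‖ ^ 2 ≤ ε * ‖φ‖ ^ 2 := by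
    have hTη : 0 < ‖T η‖ := norm_pos_iff.mpr hη
    -- `L` is the size required of `φ`: the second summand makes `2 ‖z² η‖ ≤ √ε ‖φ‖`, and the first
    -- keeps `φ` nonzero. Then `t` is chosen so that `‖t T η‖ = ‖z η‖ + L`, and the triangle
    -- inequality gives `‖φ‖ ≥ L`.
    set L := 1 + 2 / Real.sqrt ε * ‖z ^ 2 • η‖ with hL
    have hL1 : 1 ≤ L := le_add_of_nonneg_right (by positivity)
    let t : ℝ := (‖z • η‖ + L) / ‖T η‖
    have hLφ : L ≤ ‖z • η + (t * Complex.I) • T η‖ := by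
      have h1 := norm_sub_le (z • η + (t * Complex.I) • T η) (z • η)
      rw [add_sub_cancel_left, norm_smul, norm_mul, Complex.norm_I, mul_one, Complex.norm_real,
        Real.norm_of_nonneg (by positivity), div_mul_cancel₀ _ hTη.ne'] at h1
      linarith
    refine ⟨t, z • η + (t * Complex.I) • T η, ?_, by linarith, ?_⟩
    · have : T (T η) = 0 := by
        change (T * T) η = 0
        rw [hT, zero_apply]
      rw [map_add, map_smul, map_smul, this]
      module
    · have h2 : 2 * ‖z ^ 2 • η‖ ≤ Real.sqrt ε * ‖z • η + (t * Complex.I) • T η‖ := by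
        refine le_trans ?_ (mul_le_mul_of_nonneg_left hLφ (Real.sqrt_nonneg _))
        rw [hL, mul_add, mul_one, ← mul_assoc, mul_div_cancel₀ _ (Real.sqrt_pos.mpr hε).ne']
        exact le_add_of_nonneg_left (Real.sqrt_nonneg _)
      have h3 := pow_le_pow_left₀ (by positivity) h2 2
      rw [mul_pow, mul_pow, Real.sq_sqrt hε.le] at h3
      linarith
  -- The cutoff scale is `1 / r`. The constant `4`, here and in `hφε`, leaves `ε / 2` for each of
  -- the two errors after `(a + b)² ≤ 2 (a² + b²)`.
  obtain ⟨r, hr0, hr⟩ : ∃ r : ℝ, 0 < r ∧ 4 * (r ^ 2 * (K ^ 2 * B)) ≤ ε * A := by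
    set c := min 1 (ε * A / (4 * (K ^ 2 * B + 1)))
    have hKB : 0 ≤ K ^ 2 * B := by positivity
    have hc0 : 0 < c := lt_min one_pos (by positivity)
    refine ⟨c, hc0, ?_⟩
    have h1 : c ^ 2 ≤ ε * A / (4 * (K ^ 2 * B + 1)) := by
      calc c ^ 2 = c * c := sq c
        _ ≤ c * 1 := mul_le_mul_of_nonneg_left (min_le_left _ _) hc0.le
        _ ≤ _ := by rw [mul_one]; exact min_le_right _ _
    rw [le_div_iff₀ (by positivity)] at h1
    nlinarith [sq_nonneg c]
  let w : ι → ℝ := fun j => t * a j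
  have hw : ∑ j, (w j : ℂ) • M j = (t : ℂ) • T := by
    simp only [w, T, Finset.smul_sum, smul_smul, Complex.ofReal_mul]
  let ψ : EuclideanSpace ℝ ι → F := fun x => χ (r • x) • planeWave w φ x
  have hχr : ContDiff ℝ ∞ fun x : EuclideanSpace ℝ ι => χ (r • x) :=
    hχ.comp (contDiff_const_smul r)
  have hψ : ContDiff ℝ ∞ ψ := hχr.smul (contDiff_planeWave w φ)
  have hψc : HasCompactSupport ψ := (hχc.comp_smul hr0.ne').smul_right
  have hsq : ∀ x, ‖ψ x‖ ^ 2 = χ (r • x) ^ 2 * ‖φ‖ ^ 2 := fun x => by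
    simp only [ψ, norm_smul, norm_planeWave, mul_pow, Real.norm_eq_abs, sq_abs]
  have hDψ : ∀ x, ‖z • ψ x - firstOrder M ψ x‖ ^ 2 ≤
      χ (r • x) ^ 2 * (2 * ‖z ^ 2 • η‖ ^ 2) +
        ‖fderiv ℝ χ (r • x)‖ ^ 2 * (2 * (r ^ 2 * K ^ 2 * ‖φ‖ ^ 2)) := by
    intro x
    have h1 : z • ψ x - firstOrder M ψ x = χ (r • x) • planeWave w (z ^ 2 • η) x -
        ∑ j, fderiv ℝ (fun y => χ (r • y)) x (EuclideanSpace.single j 1) •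
          M j (planeWave w φ x) := by
      rw [firstOrder_smul M (hχr.differentiable (by simp) x)
        ((contDiff_planeWave w φ).differentiable (by simp) x), firstOrder_planeWave, hw, ← hφ]
      have : planeWave w (z • φ - (t * Complex.I) • T φ) x =
          z • planeWave w φ x - planeWave w (Complex.I • ((t : ℂ) • T) φ) x := by
        simp only [planeWave, smul_apply, smul_sub, smul_smul]
        congr 2 <;> ring
      rw [this]
      simp only [ψ, smul_sub, smul_comm z (χ (r • x))]
      abel
    have h2 : ‖z • ψ x - firstOrder M ψ x‖ ≤
        |χ (r • x)| * ‖z ^ 2 • η‖ + K * (r * ‖fderiv ℝ χ (r • x)‖) * ‖φ‖ := by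
      rw [h1]
      refine (norm_sub_le _ _).trans (add_le_add ?_ ?_)
      · rw [norm_smul, norm_planeWave, Real.norm_eq_abs]
      · have := norm_sum_smul_le M (fderiv ℝ (fun y => χ (r • y)) x) (planeWave w φ x)
        refine this.trans (le_of_eq ?_)
        rw [fderiv_comp_smul χ hχd, norm_smul, Real.norm_of_nonneg hr0.le, norm_planeWave]
    refine (pow_le_pow_left₀ (norm_nonneg _) h2 2).trans ?_
    refine (add_sq_le).trans (le_of_eq ?_)
    rw [mul_pow, sq_abs]; ring
  -- The Jacobian of the rescaling; it multiplies both sides of the final estimate equally.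
  set s : ℝ := |(r ^ Module.finrank ℝ (EuclideanSpace ℝ ι))⁻¹| with hs
  have hs0 : 0 < s := abs_pos.mpr (by positivity)
  have hIA : ∫ x : EuclideanSpace ℝ ι, χ (r • x) ^ 2 = s * A := by
    rw [Measure.integral_comp_smul volume (fun x => χ x ^ 2) r, smul_eq_mul]
  have hIB : ∫ x : EuclideanSpace ℝ ι, ‖fderiv ℝ χ (r • x)‖ ^ 2 = s * B := by
    rw [Measure.integral_comp_smul volume (fun x => ‖fderiv ℝ χ x‖ ^ 2) r, smul_eq_mul]
  have hi1 : Integrable (fun x : EuclideanSpace ℝ ι => χ (r • x) ^ 2) :=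
    (hc1.integrable_of_hasCompactSupport hs1).comp_smul hr0.ne'
  have hi2 : Integrable (fun x : EuclideanSpace ℝ ι => ‖fderiv ℝ χ (r • x)‖ ^ 2) :=
    (hc2.integrable_of_hasCompactSupport hs2).comp_smul hr0.ne'
  have hnorm : ∫ x, ‖ψ x‖ ^ 2 = s * A * ‖φ‖ ^ 2 := by
    simp only [hsq]
    rw [integral_mul_const, hIA]
  refine ⟨ψ, hψ, hψc, ?_, ?_⟩
  · rw [hnorm]; positivity
  · have hmono := integral_mono_of_nonneg (μ := volume)
      (Eventually.of_forall fun x => sq_nonneg ‖z • ψ x - firstOrder M ψ x‖)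
      ((hi1.mul_const (2 * ‖z ^ 2 • η‖ ^ 2)).add
        (hi2.mul_const (2 * (r ^ 2 * K ^ 2 * ‖φ‖ ^ 2)))) (Eventually.of_forall hDψ)
    refine hmono.trans ?_
    simp only [Pi.add_apply]
    rw [integral_add (hi1.mul_const _) (hi2.mul_const _), integral_mul_const, integral_mul_const,
      hIA, hIB, hnorm]
    have h1 := mul_le_mul_of_nonneg_left hφε (mul_pos hs0 hA0).le
    have h2 := mul_le_mul_of_nonneg_left hr (mul_nonneg hs0.le (sq_nonneg ‖φ‖))
    nlinarith

end ApproximateEigenfunctions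

/-! ### The Dirac operator as a first order operator -/

/-- Clifford multiplication by `e_j`. -/
noncomputable def gammaOp (p q : ℕ) (j : Fin (p + q)) : Δ p q →L[ℂ] Δ p q :=
  act (vec p q (Pi.single j 1))

/-- The coefficients of the Dirac operator. -/
noncomputable def diracCoeff (p q : ℕ) (j : Fin (p + q)) : Δ p q →L[ℂ] Δ p q :=
  (metricSign p q j : ℂ) • gammaOp p q j

theorem gammaOp_anticomm (i j : Fin (p + q)) (h : i ≠ j) :
    gammaOp p q i * gammaOp p q j + gammaOp p q j * gammaOp p q i = 0 := by
  rw [gammaOp, gammaOp, ← act_mul_eq, ← act_mul_eq, ← act_add, vec_anticomm h, neg_add_cancel]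
  simp [act]

theorem gammaOp_sq (j : Fin (p + q)) :
    gammaOp p q j * gammaOp p q j = -((metricSign p q j : ℂ) • 1) := by
  rw [gammaOp, ← act_mul_eq, CliffordAlgebra.ι_sq_scalar, negForm_single,
    Algebra.algebraMap_eq_smul_one, act_smul, act_one_eq, Complex.ofReal_neg]
  exact neg_smul (metricSign p q j : ℂ) (1 : Δ p q →L[ℂ] Δ p q)

theorem metricSign_mul_self_complex (j : Fin (p + q)) :
    (metricSign p q j : ℂ) * metricSign p q j = 1 := by
  rw [← Complex.ofReal_mul, metricSign_mul_self, Complex.ofReal_one]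

theorem diracCoeff_anticomm (i j : Fin (p + q)) (h : i ≠ j) :
    diracCoeff p q i * diracCoeff p q j + diracCoeff p q j * diracCoeff p q i = 0 := by
  rw [diracCoeff, diracCoeff, smul_mul_smul_comm, smul_mul_smul_comm,
    mul_comm (metricSign p q j : ℂ)]
  exact (smul_add _ _ _).symm.trans
    ((congrArg _ (gammaOp_anticomm i j h)).trans (smul_zero _))

theorem diracCoeff_sq (j : Fin (p + q)) :
    diracCoeff p q j * diracCoeff p q j = -((metricSign p q j : ℂ) • 1) := by
  rw [diracCoeff, smul_mul_smul_comm, metricSign_mul_self_complex, one_smul, gammaOp_sq]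

theorem star_diracCoeff (j : Fin (p + q)) : star (diracCoeff p q j) = -gammaOp p q j := by
  rw [diracCoeff, star_smul, RCLike.star_def, Complex.conj_ofReal, gammaOp, star_act_single,
    smul_smul, Complex.ofReal_neg, mul_neg, metricSign_mul_self_complex]
  exact neg_one_smul ℂ (act (vec p q (Pi.single j 1)))

theorem diracFun_eq_firstOrder (ψ : Base p q → Δ p q) :
    diracFun p q ψ = firstOrder (diracCoeff p q) ψ := by
  funext x
  refine Finset.sum_congr rfl fun j _ => ?_
  exact (Complex.coe_smul _ _).symm

theorem metricSign_ne_zero (j : Fin (p + q)) : metricSign p q j ≠ 0 := by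
  unfold metricSign; split_ifs <;> norm_num

/-- Shows that two anticommuting generators, one of them with square `1`, cannot cancel, so the
symbol in a null direction is not zero. -/
theorem mul_self_add_mul_self_eq_zero {R : Type*} [Ring R] {a b : R} (h : a + b = 0)
    (h' : a * b + b * a = 0) : a * a + a * a = 0 := by
  rw [eq_neg_of_add_eq_zero_right h] at h'
  rw [← neg_eq_zero, ← h']
  noncomm_ring

/-- A direction in which the symbol of the Dirac operator is nilpotent and nonzero. -/
theorem exists_null_direction (hp : 0 < p) (hq : 0 < q) :
    ∃ a : Fin (p + q) → ℝ,
      (∑ j, (a j : ℂ) • diracCoeff p q j) * (∑ j, (a j : ℂ) • diracCoeff p q j) = 0 ∧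
      ∃ η : Δ p q, (∑ j, (a j : ℂ) • diracCoeff p q j) η ≠ 0 := by
  let i : Fin (p + q) := ⟨0, by omega⟩
  let k : Fin (p + q) := ⟨p, by omega⟩
  have hik : i ≠ k := fun h => hp.ne (congrArg Fin.val h)
  have hi : metricSign p q i = -1 := if_pos hp
  have hk : metricSign p q k = 1 := if_neg (lt_irrefl p)
  -- One time-like and one space-like direction: the squares of the two coefficients are `1` and
  -- `-1`, and the mixed terms cancel by anticommutation.
  let a : Fin (p + q) → ℝ := Pi.single i 1 + Pi.single k 1
  have hsum : ∀ {V : Type} [AddCommGroup V] [Module ℂ V] (f : Fin (p + q) → V),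
      ∑ j, (a j : ℂ) • f j = f i + f k := by
    intro V _ _ f
    simp only [a, Pi.add_apply, Complex.ofReal_add, add_smul, Finset.sum_add_distrib,
      Pi.single_apply]
    simp
  have hT : ∑ j, (a j : ℂ) • diracCoeff p q j = diracCoeff p q i + diracCoeff p q k := hsum _
  refine ⟨a, ?_, ?_⟩
  · rw [hT, add_mul, mul_add, mul_add, diracCoeff_sq, diracCoeff_sq, hi, hk]
    have := diracCoeff_anticomm i k hik
    calc _ = (diracCoeff p q i * diracCoeff p q k + diracCoeff p q k * diracCoeff p q i) := by
            push_cast; module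
      _ = 0 := this
  · by_contra! hcon
    have h0 : diracCoeff p q i + diracCoeff p q k = 0 := by
      rw [← hT]; exact ContinuousLinearMap.ext hcon
    have h1 := mul_self_add_mul_self_eq_zero h0 (diracCoeff_anticomm i k hik)
    have h2 : diracCoeff p q i * diracCoeff p q i = 1 := by
      rw [diracCoeff_sq, hi]
      ext; simp
    rw [h2] at h1
    let φ : Δ p q := EuclideanSpace.single default 1
    have h3 : φ + φ = 0 := congrArg (fun T : Δ p q →L[ℂ] Δ p q => T φ) h1
    have h4 : φ = 0 := by
      rw [← two_smul ℂ] at h3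
      exact (smul_eq_zero.mp h3).resolve_left two_ne_zero
    simp [φ] at h4

/-! ### Comparison of `L²_ξ(S)` with the standard `L²` space -/

open MeasureTheory

theorem memLp_testSpinor (ψ : testSpinors p q) : MemLp ψ.1 2 volume :=
  ψ.2.1.continuous.memLp_of_hasCompactSupport ψ.2.2

/-- Test spinors as elements of the standard `L²` space. -/
noncomputable def testToLp (p q : ℕ) :
    testSpinors p q →ₗ[ℂ] Lp (Δ p q) 2 (volume : Measure (Base p q)) where
  toFun ψ := (memLp_testSpinor ψ).toLp ψ.1
  map_add' _ _ := rfl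
  map_smul' _ _ := rfl

theorem inner_testToLp (u : Lp (Δ p q) 2 (volume : Measure (Base p q))) (ψ : testSpinors p q) :
    inner ℂ u (testToLp p q ψ) = ∫ x, inner ℂ (u x) (ψ.1 x) := by
  rw [L2.inner_def]
  refine integral_congr_ae ?_
  filter_upwards [(memLp_testSpinor ψ).coeFn_toLp] with x hx
  change inner ℂ (u x) (((memLp_testSpinor ψ).toLp ψ.1 : Base p q → Δ p q) x) = _
  rw [hx]

theorem inner_testToLp_testToLp (φ ψ : testSpinors p q) :
    inner ℂ (testToLp p q φ) (testToLp p q ψ) = ∫ x, inner ℂ (φ.1 x) (ψ.1 x) := by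
  rw [inner_testToLp]
  refine integral_congr_ae ?_
  filter_upwards [(memLp_testSpinor φ).coeFn_toLp] with x hx
  change inner ℂ (((memLp_testSpinor φ).toLp φ.1 : Base p q → Δ p q) x) _ = _
  rw [hx]

theorem norm_testToLp_sq (ψ : testSpinors p q) :
    ‖testToLp p q ψ‖ ^ 2 = ∫ x, ‖ψ.1 x‖ ^ 2 := by
  have h := inner_self_eq_norm_sq_to_K (𝕜 := ℂ) (testToLp p q ψ)
  rw [inner_testToLp_testToLp] at h
  have h2 : ∫ x, inner ℂ (ψ.1 x) (ψ.1 x) = ((∫ x, ‖ψ.1 x‖ ^ 2 : ℝ) : ℂ) := by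
    rw [← integral_complex_ofReal]
    refine integral_congr_ae (.of_forall fun x => ?_)
    simp only [inner_self_eq_norm_sq_to_K]
    norm_cast
  rw [h2] at h
  refine Complex.ofReal_injective ?_
  rw [Complex.ofReal_pow]
  exact h.symm

theorem firstOrder_mem (M : Fin (p + q) → Δ p q →L[ℂ] Δ p q) (ψ : testSpinors p q) :
    firstOrder M ψ.1 ∈ testSpinors p q := by
  constructor
  · unfold firstOrder
    refine ContDiff.sum fun j _ => ((M j).restrictScalars ℝ).contDiff.comp ?_
    exact (ψ.2.1.fderiv_right (m := ∞) (by simp)).clm_apply contDiff_const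
  · refine (ψ.2.2.fderiv ℝ).mono fun x hx hx0 => hx ?_
    simp [firstOrder, hx0]

/-- The operator `∑ γ_j ∂_j`, the formal adjoint of the Dirac operator. -/
noncomputable def adjointDirac (ψ : testSpinors p q) : testSpinors p q :=
  ⟨firstOrder (gammaOp p q) ψ.1, firstOrder_mem _ ψ⟩

theorem inner_diracLin (φ ψ : testSpinors p q) :
    inner ℂ (testToLp p q φ) (testToLp p q (diracLin p q ψ)) =
      inner ℂ (testToLp p q (adjointDirac φ)) (testToLp p q ψ) := by
  rw [inner_testToLp_testToLp, inner_testToLp_testToLp]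
  have h := integral_inner_firstOrder (diracCoeff p q) (φ.2.2.toSchwartzMap φ.2.1)
    (ψ.2.2.toSchwartzMap ψ.2.1)
  have h1 : ∀ x, firstOrder (fun j => star (diracCoeff p q j)) φ.1 x =
      -firstOrder (gammaOp p q) φ.1 x := by
    intro x
    simp [firstOrder, star_diracCoeff]
  have h2 : ∀ x, (diracLin p q ψ).1 x = firstOrder (diracCoeff p q) ψ.1 x := fun x =>
    congrFun (diracFun_eq_firstOrder ψ.1) x
  change ∫ x, inner ℂ (φ.1 x) (firstOrder (diracCoeff p q) ψ.1 x) =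
    -∫ x, inner ℂ (firstOrder (fun j => star (diracCoeff p q j)) φ.1 x) (ψ.1 x) at h
  simp only [h1, inner_neg_left, integral_neg, neg_neg] at h
  simp only [h2]
  exact h

theorem eq_zero_of_inner_dirac (hp : 0 < p) (z : ℂ)
    (u : Lp (Δ p q) 2 (volume : Measure (Base p q)))
    (h : ∀ ψ : testSpinors p q, inner ℂ u (testToLp p q (z • ψ - diracLin p q ψ)) = 0) :
    u = 0 := by
  refine eq_zero_of_weak_solution diracCoeff_anticomm diracCoeff_sq
    (metricSign_ne_zero ⟨0, by omega⟩) z u fun ψ hψ hψc => ?_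
  rw [← h ⟨ψ, hψ, hψc⟩, inner_testToLp]
  refine integral_congr_ae (.of_forall fun x => ?_)
  change _ = inner ℂ (u x) (z • ψ x - diracFun p q ψ x)
  rw [diracFun_eq_firstOrder]

theorem eq_zero_of_inner_adjointDirac (hp : 0 < p) (z : ℂ)
    (u : Lp (Δ p q) 2 (volume : Measure (Base p q)))
    (h : ∀ ψ : testSpinors p q, inner ℂ u (testToLp p q (z • ψ - adjointDirac ψ)) = 0) :
    u = 0 := by
  refine eq_zero_of_weak_solution gammaOp_anticomm gammaOp_sq
    (metricSign_ne_zero ⟨0, by omega⟩) z u fun ψ hψ hψc => ?_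
  rw [← h ⟨ψ, hψ, hψc⟩, inner_testToLp]
  rfl

theorem exists_approximate_eigenspinor (hp : 0 < p) (hq : 0 < q) (z : ℂ) {δ : ℝ} (hδ : 0 < δ) :
    ∃ ψ : testSpinors p q, 0 < ‖testToLp p q ψ‖ ∧
      ‖testToLp p q (z • ψ - diracLin p q ψ)‖ ≤ δ * ‖testToLp p q ψ‖ := by
  obtain ⟨a, ha, η, hη⟩ := exists_null_direction hp hq
  obtain ⟨ψ, hψ, hψc, hpos, hle⟩ :=
    -- The estimate concerns squared norms, so the tolerance is `δ²`.
    exists_approximate_eigenfunction (diracCoeff p q) a ha hη z (pow_pos hδ 2)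
  refine ⟨⟨ψ, hψ, hψc⟩, ?_, ?_⟩
  · rw [← norm_testToLp_sq ⟨ψ, hψ, hψc⟩] at hpos
    exact lt_of_le_of_ne (norm_nonneg _) fun h0 => by simp [← h0] at hpos
  · refine le_of_sq_le_sq ?_ (by positivity)
    rw [mul_pow, norm_testToLp_sq, norm_testToLp_sq]
    refine le_trans (le_of_eq ?_) hle
    refine integral_congr_ae (.of_forall fun x => ?_)
    change ‖z • ψ x - diracFun p q ψ x‖ ^ 2 = _
    rw [diracFun_eq_firstOrder]

section Comparison

variable {ξ : Base p q → Submodule ℝ (Fin (p + q) → ℝ)} (h : SpinorMetric ξ)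

theorem norm_preL2_sq (ψ : PreL2 h) :
    ‖ψ‖ ^ 2 = ∫ x, (h.density ψ.1 ψ.1 x).re := by
  rw [← inner_self_eq_norm_sq (𝕜 := ℂ) ψ]
  exact (integral_re (h.integrable_density ψ ψ)).symm

theorem integrable_norm_sq (ψ : testSpinors p q) : Integrable fun x => ‖ψ.1 x‖ ^ 2 :=
  (memLp_testSpinor ψ).integrable_norm_pow (by norm_num)

variable {h} {K : ℝ}

/-- Adapted spin frames act with operator norms bounded by `K`, as do their inverses. -/
def FramesBoundedBy (ξ : Base p q → Submodule ℝ (Fin (p + q) → ℝ)) (K : ℝ) : Prop :=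
  ∀ x, ∀ g ∈ adaptedSpinFrames (ξ x),
    ‖act (g : Cl p q)‖ ≤ K ∧ ‖act ((g⁻¹ : (Cl p q)ˣ) : Cl p q)‖ ≤ K

/-- The density is `‖g⁻¹ φ‖²` for an adapted `g`. The bound on `g⁻¹` gives one inequality, and
writing `φ = g (g⁻¹ φ)` gives the other. -/
theorem density_bounds (hbd : FramesBoundedBy ξ K) (φ : Base p q → Δ p q) (x : Base p q) :
    (h.density φ φ x).re ≤ K ^ 2 * ‖φ x‖ ^ 2 ∧ ‖φ x‖ ^ 2 ≤ K ^ 2 * (h.density φ φ x).re := by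
  obtain ⟨g, hg, hgram⟩ := h.adapted x
  obtain ⟨h1, h2⟩ := hbd x g hg
  have hd : (h.density φ φ x).re = ‖act ((g⁻¹ : (Cl p q)ˣ) : Cl p q) (φ x)‖ ^ 2 := by
    rw [SpinorMetric.density, hgram]
    exact inner_self_eq_norm_sq (𝕜 := ℂ) _
  rw [hd, ← mul_pow, ← mul_pow]
  refine ⟨pow_le_pow_left₀ (norm_nonneg _) ?_ 2, pow_le_pow_left₀ (norm_nonneg _) ?_ 2⟩
  · exact (ContinuousLinearMap.le_opNorm _ _).trans (mul_le_mul_of_nonneg_right h2 (norm_nonneg _))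
  · have h3 := act_mul (g : Cl p q) ((g⁻¹ : (Cl p q)ˣ) : Cl p q) (φ x)
    rw [Units.mul_inv, act_one] at h3
    nth_rewrite 1 [h3]
    exact (ContinuousLinearMap.le_opNorm _ _).trans (mul_le_mul_of_nonneg_right h1 (norm_nonneg _))

theorem norm_preL2_le (hK : 0 < K) (hbd : FramesBoundedBy ξ K) (ψ : PreL2 h) :
    ‖ψ‖ ≤ K * ‖testToLp p q ψ‖ := by
  refine le_of_sq_le_sq ?_ (by positivity)
  have e1 : ‖ψ‖ ^ 2 = _ := norm_preL2_sq h ψ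
  have e2 : ‖testToLp p q ψ‖ ^ 2 = ∫ x, ‖ψ.1 x‖ ^ 2 := norm_testToLp_sq ψ
  rw [mul_pow, e1, e2, ← integral_const_mul]
  exact integral_mono (h.integrable_density ψ ψ).re ((integrable_norm_sq ψ).const_mul _)
    fun x => (density_bounds hbd ψ.1 x).1

theorem norm_testToLp_le (hK : 0 < K) (hbd : FramesBoundedBy ξ K) (ψ : PreL2 h) :
    ‖testToLp p q ψ‖ ≤ K * ‖ψ‖ := by
  refine le_of_sq_le_sq ?_ (by positivity)
  have e1 : ‖ψ‖ ^ 2 = _ := norm_preL2_sq h ψ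
  have e2 : ‖testToLp p q ψ‖ ^ 2 = ∫ x, ‖ψ.1 x‖ ^ 2 := norm_testToLp_sq ψ
  rw [mul_pow, e1, e2, ← integral_const_mul]
  exact integral_mono (integrable_norm_sq ψ) ((h.integrable_density ψ ψ).re.const_mul _)
    fun x => (density_bounds hbd ψ.1 x).2

/-- `L²_ξ(S)` embeds into the standard `L²` space. -/
theorem exists_embedding (hK : 0 < K) (hbd : FramesBoundedBy ξ K) :
    ∃ J : L2 h →L[ℂ] Lp (Δ p q) 2 (volume : Measure (Base p q)),
    (∀ ψ : PreL2 h, J (toL2 h ψ) = testToLp p q ψ) ∧ ∀ y, ‖y‖ ≤ K * ‖J y‖ := by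
  let J₀ : PreL2 h →L[ℂ] Lp (Δ p q) 2 (volume : Measure (Base p q)) :=
    LinearMap.mkContinuous (testToLp p q : PreL2 h →ₗ[ℂ] _) K (norm_testToLp_le hK hbd)
  let e : PreL2 h →L[ℂ] L2 h := UniformSpace.Completion.toComplL
  have hJ : ∀ ψ : PreL2 h, J₀.extend e (e ψ) = testToLp p q ψ := fun ψ =>
    ContinuousLinearMap.extend_eq J₀ UniformSpace.Completion.denseRange_coe
      (UniformSpace.Completion.isUniformInducing_coe _) ψ
  refine ⟨J₀.extend e, hJ, fun y => ?_⟩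
  induction y using UniformSpace.Completion.induction_on with
  | hp =>
    exact isClosed_le (continuous_norm (E := L2 h))
      (continuous_const.mul (J₀.extend e).continuous.norm)
  | ih ψ =>
    rw [UniformSpace.Completion.norm_coe]
    exact (norm_preL2_le hK hbd ψ).trans (le_of_eq (congrArg (fun v => K * ‖v‖) (hJ ψ).symm))

end Comparison

/-! ### The spectrum of the Dirac operator -/

section Spectrum

open MeasureTheory

variable {ξ : Base p q → Submodule ℝ (Fin (p + q) → ℝ)} {h : SpinorMetric ξ} {K : ℝ}
  {J : L2 h →L[ℂ] Lp (Δ p q) 2 (volume : Measure (Base p q))}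

/-- Elements of the closed graph of the Dirac operator are weak solutions. -/
theorem inner_of_mem_graph_closure (hJ : ∀ ψ : PreL2 h, J (toL2 h ψ) = testToLp p q ψ)
    {v : L2 h × L2 h} (hv : v ∈ (dirac h).graph.topologicalClosure) (φ : testSpinors p q) :
    inner ℂ (testToLp p q φ) (J v.2) = inner ℂ (testToLp p q (adjointDirac φ)) (J v.1) := by
  have hclosed : IsClosed {v : L2 h × L2 h |
      inner ℂ (testToLp p q φ) (J v.2) = inner ℂ (testToLp p q (adjointDirac φ)) (J v.1)} :=
    isClosed_eq (continuous_const.inner (J.continuous.comp continuous_snd))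
      (continuous_const.inner (J.continuous.comp continuous_fst))
  refine closure_minimal ?_ hclosed hv
  intro v hv
  obtain ⟨y, hy1, hy2⟩ := (LinearPMap.mem_graph_iff _).mp hv
  obtain ⟨_, ψ, rfl⟩ := y
  have h1 : dirac h ⟨toL2 h ψ, ψ, rfl⟩ = toL2 h (diracLin p q ψ) := dirac_apply h ψ
  change inner ℂ (testToLp p q φ) (J v.2) = inner ℂ (testToLp p q (adjointDirac φ)) (J v.1)
  have h2 : J (toL2 h (diracLin p q ψ)) = testToLp p q (diracLin p q ψ) := hJ _
  rw [← hy1, ← hy2, h1, h2, hJ]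
  exact inner_diracLin φ ψ

/-- An eigenvector of the closure for `z` is a weak solution: its image in `L²` is orthogonal to the
range of `conj z - ∑ γ_j ∂_j`, and the uniqueness theorem for the formal adjoint applies. -/
theorem eq_zero_of_mem_graph_closure (hp : 0 < p)
    (hJ : ∀ ψ : PreL2 h, J (toL2 h ψ) = testToLp p q ψ) (hJK : ∀ y, ‖y‖ ≤ K * ‖J y‖)
    {x : L2 h} {z : ℂ} (hx : (x, z • x) ∈ (dirac h).graph.topologicalClosure) : x = 0 := by
  have h0 : J x = 0 := by
    refine eq_zero_of_inner_adjointDirac hp ((starRingEnd ℂ) z) (J x) fun ψ => ?_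
    have h1 := inner_of_mem_graph_closure hJ hx ψ
    rw [← inner_conj_symm, map_sub, map_smul, inner_sub_left, ← h1, inner_smul_left, map_smul,
      inner_smul_right, Complex.conj_conj, sub_self, map_zero]
  have h2 := hJK x
  rw [h0, norm_zero, mul_zero] at h2
  exact norm_le_zero_iff.mp h2

theorem isClosable_dirac (hp : 0 < p)
    (hJ : ∀ ψ : PreL2 h, J (toL2 h ψ) = testToLp p q ψ) (hJK : ∀ y, ‖y‖ ≤ K * ‖J y‖) :
    (dirac h).IsClosable := by
  refine ⟨(dirac h).graph.topologicalClosure.toLinearPMap,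
    (Submodule.toLinearPMap_graph_eq _ ?_).symm⟩
  rintro ⟨x, y⟩ hxy (rfl : x = 0)
  have h0 : J y = 0 := by
    -- For `(0, y)` in the closed graph, `J y` is orthogonal to all test spinors. In particular it
    -- is orthogonal to the range of `0 - D`, so the uniqueness theorem with `z = 0` gives `J y =
    -- 0`.
    refine eq_zero_of_inner_dirac hp 0 (J y) fun ψ => ?_
    have h1 := inner_of_mem_graph_closure hJ hxy ((0 : ℂ) • ψ - diracLin p q ψ)
    rw [map_zero, inner_zero_right] at h1
    rw [← inner_conj_symm, h1, map_zero]
  have h2 := hJK y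
  rw [h0, norm_zero, mul_zero] at h2
  exact norm_le_zero_iff.mp h2

/-- Formulated for an arbitrary extension `T`, so that it serves the operator on test spinors and
its closure alike. -/
theorem shift_toL2 {T : L2 h →ₗ.[ℂ] L2 h} (hT : dirac h ≤ T) (z : ℂ) (ψ : testSpinors p q) :
    ∃ y : T.domain, (y : L2 h) = toL2 h ψ ∧
      shift T z y = toL2 h (z • ψ - diracLin p q ψ : testSpinors p q) := by
  have hmem : toL2 h ψ ∈ (dirac h).domain := ⟨ψ, rfl⟩
  refine ⟨⟨toL2 h ψ, hT.1 hmem⟩, rfl, ?_⟩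
  have h1 : T ⟨toL2 h ψ, hT.1 hmem⟩ = toL2 h (diracLin p q ψ) :=
    (hT.2 (x := ⟨toL2 h ψ, hmem⟩) (y := ⟨toL2 h ψ, hT.1 hmem⟩) rfl).symm.trans (dirac_apply h ψ)
  change z • toL2 h ψ - T ⟨toL2 h ψ, hT.1 hmem⟩ = _
  rw [h1]
  exact ((map_sub (toL2 h) _ _).trans (congrArg (· - _) (map_smul (toL2 h) z _))).symm

theorem not_inverseBounded (hp : 0 < p) (hq : 0 < q) (hK : 0 < K)
    (hJ : ∀ ψ : PreL2 h, J (toL2 h ψ) = testToLp p q ψ) (hJK : ∀ y, ‖y‖ ≤ K * ‖J y‖)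
    {T : L2 h →ₗ.[ℂ] L2 h} (hT : dirac h ≤ T) (z : ℂ) : ¬ InverseBounded T z := by
  rintro ⟨C, hC⟩
  -- Small enough that `‖J‖ |C| K δ < 1`. A bounded inverse would give `N ≤ ‖J‖ |C| K δ N` for the
  -- norm `N > 0` of the approximate eigenspinor.
  set δ : ℝ := (2 * (‖J‖ * |C| * K + 1))⁻¹ with hδ
  have hδ0 : 0 < δ := by positivity
  obtain ⟨ψ, hψ0, hψ⟩ := exists_approximate_eigenspinor hp hq z hδ0
  obtain ⟨y, hy1, hy2⟩ := shift_toL2 hT z ψ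
  have h1 := hC y
  have h2 := hJK (shift T z y)
  have h3 := J.le_opNorm (y : L2 h)
  rw [hy2] at h1 h2
  have e1 : J (toL2 h (z • ψ - diracLin p q ψ : testSpinors p q)) =
    testToLp p q (z • ψ - diracLin p q ψ) := hJ _
  have e2 : J (toL2 h ψ) = testToLp p q ψ := hJ ψ
  rw [e1] at h2
  rw [hy1] at h1 h3
  rw [e2] at h3
  set N := ‖testToLp p q ψ‖
  have h4 : N ≤ ‖J‖ * |C| * K * (δ * N) := by
    calc N ≤ ‖J‖ * ‖toL2 h ψ‖ := h3
      _ ≤ ‖J‖ * (|C| * (K * (δ * N))) := by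
          refine mul_le_mul_of_nonneg_left (h1.trans ?_) J.opNorm_nonneg
          refine (mul_le_mul_of_nonneg_right (le_abs_self C) (norm_nonneg _)).trans ?_
          exact mul_le_mul_of_nonneg_left (h2.trans (mul_le_mul_of_nonneg_left hψ hK.le))
            (abs_nonneg C)
      _ = _ := by ring
  have h5 : ‖J‖ * |C| * K * δ < 1 := by
    have hX : 0 ≤ ‖J‖ * |C| * K := by positivity
    rw [hδ, ← div_eq_mul_inv, div_lt_one (by positivity)]
    linarith
  nlinarith

/-- The range on test spinors is dense in the standard `L²`, since its orthogonal complement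
vanishes by uniqueness. The inequality `‖y‖ ≤ K ‖J y‖` transfers the approximation of `J y` back to
`y`. -/
theorem dense_range_shift (hp : 0 < p) (hK : 0 < K)
    (hJ : ∀ ψ : PreL2 h, J (toL2 h ψ) = testToLp p q ψ) (hJK : ∀ y, ‖y‖ ≤ K * ‖J y‖)
    {T : L2 h →ₗ.[ℂ] L2 h} (hT : dirac h ≤ T) (z : ℂ) :
    Dense (LinearMap.range (shift T z) : Set (L2 h)) := by
  let V : Submodule ℂ (Lp (Δ p q) 2 (volume : Measure (Base p q))) :=
    LinearMap.range ((testToLp p q).comp (z • LinearMap.id - diracLin p q))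
  have hV : V.topologicalClosure = ⊤ := by
    rw [Submodule.topologicalClosure_eq_top_iff, Submodule.eq_bot_iff]
    intro u hu
    refine eq_zero_of_inner_dirac hp z u fun ψ => ?_
    exact Submodule.inner_left_of_mem_orthogonal (LinearMap.mem_range_self _ ψ) hu
  intro y
  rw [Metric.mem_closure_iff]
  intro ε hε
  have hy : J y ∈ closure (V : Set (Lp (Δ p q) 2 (volume : Measure (Base p q)))) := by
    rw [← Submodule.topologicalClosure_coe, hV]; trivial
  obtain ⟨_, ⟨ψ, rfl⟩, hψ⟩ := Metric.mem_closure_iff.mp hy (ε / K) (by positivity)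
  obtain ⟨w, -, hw⟩ := shift_toL2 hT z ψ
  refine ⟨shift T z w, LinearMap.mem_range_self _ w, ?_⟩
  have e1 : J (toL2 h (z • ψ - diracLin p q ψ : testSpinors p q)) =
    testToLp p q (z • ψ - diracLin p q ψ) := hJ _
  have h1 := hJK (y - shift T z w)
  rw [map_sub, hw, e1, ← dist_eq_norm, ← dist_eq_norm] at h1
  rw [hw]
  refine h1.trans_lt ?_
  have h2 : dist (J y) (testToLp p q (z • ψ - diracLin p q ψ)) < ε / K := hψ
  rwa [lt_div_iff₀ hK, mul_comm] at h2

theorem ker_shift_closure (hp : 0 < p)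
    (hJ : ∀ ψ : PreL2 h, J (toL2 h ψ) = testToLp p q ψ) (hJK : ∀ y, ‖y‖ ≤ K * ‖J y‖) (z : ℂ) :
    LinearMap.ker (shift (dirac h).closure z) = ⊥ := by
  rw [Submodule.eq_bot_iff]
  intro y hy
  have hy' : (dirac h).closure y = z • (y : L2 h) := (sub_eq_zero.mp hy).symm
  have hg : ((y : L2 h), z • (y : L2 h)) ∈ (dirac h).graph.topologicalClosure := by
    rw [(isClosable_dirac hp hJ hJK).graph_closure_eq_closure_graph, ← hy']
    exact LinearPMap.mem_graph _ y
  exact Subtype.ext (eq_zero_of_mem_graph_closure hp hJ hJK hg)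

end Spectrum

end PseudoDirac

theorem mainTheorem6 (p q : ℕ) (hp : 0 < p) (hq : 0 < q)
    (A : PseudoDirac.Base p q → Matrix (Fin (p + q)) (Fin (p + q)) ℝ)
    (hA : ∀ i j, ContDiff ℝ ∞ (fun x => A x i j))
    (hSO : ∀ x, A x ∈ PseudoDirac.SO₀ p q)
    (hbdd : ∃ C : ℝ, ∀ x, ‖Matrix.toEuclideanCLM (𝕜 := ℝ) (A x)‖ ≤ C)
    (hbdd_inv : ∃ C : ℝ, ∀ x, ‖Matrix.toEuclideanCLM (𝕜 := ℝ) (A x)⁻¹‖ ≤ C) :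
    Nonempty (PseudoDirac.SpinorMetric (PseudoDirac.inducedSubbundle A)) ∧
    ∀ h : PseudoDirac.SpinorMetric (PseudoDirac.inducedSubbundle A),
      (PseudoDirac.dirac h).IsClosable ∧
      PseudoDirac.spec (PseudoDirac.dirac h) = Set.univ ∧
      PseudoDirac.spec (PseudoDirac.dirac h).closure = Set.univ ∧
      PseudoDirac.contSpec (PseudoDirac.dirac h).closure = Set.univ := by
  have hcont : Continuous A := continuous_matrix fun i j => (hA i j).continuous
  refine ⟨PseudoDirac.nonempty_spinorMetric A hcont hSO, fun h => ?_⟩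
  obtain ⟨K, hK, hbd⟩ := PseudoDirac.exists_frame_bound hSO hbdd
  obtain ⟨J, hJ, hJK⟩ := PseudoDirac.exists_embedding (h := h) hK hbd
  have hle := (PseudoDirac.dirac h).le_closure
  refine ⟨PseudoDirac.isClosable_dirac hp hJ hJK, ?_, ?_, ?_⟩
  · exact Set.eq_univ_of_forall fun z hz =>
      PseudoDirac.not_inverseBounded hp hq hK hJ hJK le_rfl z hz.2.2
  · exact Set.eq_univ_of_forall fun z hz =>
      PseudoDirac.not_inverseBounded hp hq hK hJ hJK hle z hz.2.2
  · exact Set.eq_univ_of_forall fun z => ⟨PseudoDirac.ker_shift_closure hp hJ hJK z,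
      PseudoDirac.dense_range_shift hp hK hJ hJK hle z,
      PseudoDirac.not_inverseBounded hp hq hK hJ hJK hle z⟩
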